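/- Let $\Bbbk$ be an algebraically closed field of characteristic zero and let $(q_{ij})_{1\le i,j\le 2}$ be a matrix of non-zero scalars. Let $V$ be the braided vector space with basis $x_1,x_2$ and braiding $c(x_i\otimes x_j)=q_{ij}\,x_j\otimes x_i$, and let $\mathcal B(V)=T(V)/\mathcal J(V)$ be its Nichols algebra, where $\mathcal J(V)=\bigoplus_n\ker\mathfrak S_n$ and $\mathfrak S_n$ is the quantum symmetrizer on $V^{\otimes n}$. Let $g_i$ ($i=1,2$) be the algebra automorphism of $\mathcal B(V)$ with $g_i\cdot x_j=q_{ij}x_j$, and let $\partial_i$ be the linear endomorphism of $\mathcal B(V)$ with $\partial_i(x_j)=\delta_{ij}$ and $\partial_i(xy)=x\,\partial_i(y)+\partial_i(x)\,(g_i\cdot y)$. Put $\widetilde q_{12}=q_{12}q_{21}$, $(n)_t=\sum_{j=0}^{n-1}t^j$, $(n)_t^!=\prod_{j=1}^n (j)_t$. Let $q_{\alpha\beta}$ be the bicharacter on $\mathbb Z^2$ with $q_{\alpha_i\alpha_j}=q_{ij}$ for the canonical basis $\alpha_1,\alpha_2$, and for $k\in\mathbb N_0$ put $\beta_k=k\alpha_1+\alpha_2$,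 $p_k=q_{\beta_k\,\beta_k}$, $y_k=(\mathrm{ad}_c\,x_1)^k x_2\in\mathcal B(V)$, where $\mathrm{ad}_c\,x_1(y)=x_1y-(g_1\cdot y)x_1$, and $$w_k=y_{k+2}\,y_k-q_{\beta_{k+2}\,\beta_k}\;y_k\,y_{k+2}.$$ Let $m\in\mathbb N_0$. Assume that $y_{m+2}\ne0$, that $p_{m+1}\neq-1$, and that $w_k\in\Bbbk\,y_{k+1}^2$ for all $0\le k<m$. Set $$\widetilde w_m=w_m-\frac{q_{\beta_{m+1}\,\beta_m}\,(m+2)_{q_{11}}\,(1-q_{11}^{m+1}\widetilde q_{12})}{1+p_{m+1}}\;y_{m+1}^2 .$$ Then the following are equivalent: 1. $w_m\in\Bbbk\,y_{m+1}^2$; 2. $\widetilde w_m=0$; 3. $\partial_1^m\partial_2(\widetilde w_m)=0$; 4. $$0=\Big(1-\frac{p_{m+1}}{q_{11}}\Big)\Big(1+\frac{p_{m+1}}{q_{11}}+\frac{p_m\,(m+2)^!_{q_{11}}\,(1-q_{11}^m\widetilde q_{12})(1-q_{11}^{m+1}\widetilde q_{12})}{(m)^!_{q_{11}}\,(1+q_{11})\,(1+p_{m+1})}\Big).$$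 (The denominators in 4 are non-zero, because $y_{m+2}\neq0$ implies $(m+2)^!_{q_{11}}\ne0$.) -/

import Mathlib

noncomputable section

namespace NicholsDiag

/-! Throughout, `q i j` is the braiding matrix of a braided vector space `V` of diagonal type with
basis `(x_i)`, that is, `c (x_i ⊗ x_j) = q i j • x_j ⊗ x_i`.  The tensor algebra `T(V)` is the free
algebra `FreeAlgebra 𝕜 ι` on the letters `x_i = FreeAlgebra.ι 𝕜 i`. -/

section Words

variable {𝕜 : Type*} [Field 𝕜] {ι : Type*}

variable (𝕜) in
/-- The monomial `x_{w 0} x_{w 1} ⋯ x_{w (n-1)}` of `T(V)`. -/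
def word {n : ℕ} (w : Fin n → ι) : FreeAlgebra 𝕜 ι :=
  (List.ofFn fun a => FreeAlgebra.ι 𝕜 (w a)).prod

/-- The scalar by which (the Matsumoto lift to the braid group of) the permutation `σ` acts on
`x_{w 0} ⊗ ⋯ ⊗ x_{w (n-1)}`: one factor `q (w a) (w b)` for every inversion of `σ`, i.e. for every
pair `a < b` of tensor factors which have to be braided past each other. -/
def inversionScalar (q : ι → ι → 𝕜ˣ) {n : ℕ} (w : Fin n → ι) (σ : Equiv.Perm (Fin n)) : 𝕜 :=
  ∏ a : Fin n, ∏ b : Fin n, if a < b ∧ σ b < σ a then (q (w a) (w b) : 𝕜) else 1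

/-- The quantum symmetrizer `𝔖_n = ∑_{σ ∈ 𝕊_n} c_σ` applied to a monomial of degree `n`; the factor
in position `a` is moved to position `σ a`. -/
def symmWord (q : ι → ι → 𝕜ˣ) {n : ℕ} (w : Fin n → ι) : FreeAlgebra 𝕜 ι :=
  ∑ σ : Equiv.Perm (Fin n), inversionScalar q w σ • word 𝕜 (fun a => w (σ.symm a))

/-- The quantum symmetrizer `𝔖 = ⨁_n 𝔖_n : T(V) → T(V)`, defined on the basis of monomials. -/
def quantumSymm (q : ι → ι → 𝕜ˣ) : FreeAlgebra 𝕜 ι →ₗ[𝕜] FreeAlgebra 𝕜 ι :=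
  (FreeAlgebra.basisFreeMonoid 𝕜 ι).constr 𝕜 fun l => symmWord q (FreeMonoid.toList l).get

/-- The action of the group element `g_i = α_i` on `T(V)`: `g_i · x_j = q i j x_j`. -/
def tAct (q : ι → ι → 𝕜ˣ) (i : ι) : FreeAlgebra 𝕜 ι →ₐ[𝕜] FreeAlgebra 𝕜 ι :=
  FreeAlgebra.lift 𝕜 fun j => (q i j : 𝕜) • FreeAlgebra.ι 𝕜 j

theorem word_zero (w : Fin 0 → ι) : word 𝕜 w = 1 := by simp [word]

theorem word_succ {n : ℕ} (w : Fin (n + 1) → ι) :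
    word 𝕜 w = FreeAlgebra.ι 𝕜 (w 0) * word 𝕜 (fun a => w a.succ) := by
  simp [word, List.ofFn_succ]

theorem word_castSucc {n : ℕ} (w : Fin (n + 1) → ι) :
    word 𝕜 w = word 𝕜 (fun a => w a.castSucc) * FreeAlgebra.ι 𝕜 (w (Fin.last n)) := by
  rw [word, List.ofFn_succ', List.concat_eq_append]
  simp [word]

theorem basisFreeMonoid_eq_word (l : FreeMonoid ι) :
    FreeAlgebra.basisFreeMonoid 𝕜 ι l = word 𝕜 (FreeMonoid.toList l).get := by
  have h : FreeAlgebra.basisFreeMonoid 𝕜 ι l = FreeMonoid.lift (FreeAlgebra.ι 𝕜) l := by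
    simp [FreeAlgebra.basisFreeMonoid, FreeAlgebra.equivMonoidAlgebraFreeMonoid]
  rw [h, FreeMonoid.lift_apply, word]
  congr 1
  refine List.ext_getElem (by simp) fun k h1 h2 => by simp

theorem quantumSymm_word (q : ι → ι → 𝕜ˣ) {n : ℕ} (w : Fin n → ι) :
    quantumSymm q (word 𝕜 w) = symmWord q w := by
  have key : ∀ l : List ι, quantumSymm q (word 𝕜 l.get) = symmWord q l.get := fun l => by
    have := basisFreeMonoid_eq_word (𝕜 := 𝕜) (FreeMonoid.ofList l)
    rw [FreeMonoid.toList_ofList] at this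
    rw [← this, quantumSymm, Module.Basis.constr_basis, FreeMonoid.toList_ofList]
  obtain ⟨l, hl⟩ : ∃ l : List ι, (⟨l.length, l.get⟩ : Σ n, Fin n → ι) = ⟨n, w⟩ :=
    List.equivSigmaTuple.surjective _
  cases hl
  exact key l

/-- Two linear maps on `T(V)` agree if they agree on monomials. -/
theorem ext_word {M : Type*} [AddCommMonoid M] [Module 𝕜 M] {f g : FreeAlgebra 𝕜 ι →ₗ[𝕜] M}
    (h : ∀ (n : ℕ) (w : Fin n → ι), f (word 𝕜 w) = g (word 𝕜 w)) : f = g := by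
  refine (FreeAlgebra.basisFreeMonoid 𝕜 ι).ext fun l => ?_
  rw [basisFreeMonoid_eq_word]
  exact h _ _

theorem tAct_word (q : ι → ι → 𝕜ˣ) (i : ι) {n : ℕ} (w : Fin n → ι) :
    tAct q i (word 𝕜 w) = (∏ a, (q i (w a) : 𝕜)) • word 𝕜 w := by
  induction n with
  | zero => simp [word_zero]
  | succ n ih =>
    rw [word_succ, map_mul, ih, Fin.prod_univ_succ]
    simp [tAct, smul_smul, mul_comm]

/-- The permutation of `n + 1` letters moving `a` to the last position and permuting the other
letters as `τ` does. -/
def permInsert {n : ℕ} (a : Fin (n + 1)) (τ : Equiv.Perm (Fin n)) : Equiv.Perm (Fin (n + 1)) :=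
  (finSuccEquiv' a).trans ((Equiv.optionCongr τ).trans (finSuccEquiv' (Fin.last n)).symm)

theorem permInsert_self {n : ℕ} (a : Fin (n + 1)) (τ : Equiv.Perm (Fin n)) :
    permInsert a τ a = Fin.last n := by
  simp [permInsert]

theorem permInsert_succAbove {n : ℕ} (a : Fin (n + 1)) (τ : Equiv.Perm (Fin n)) (b : Fin n) :
    permInsert a τ (a.succAbove b) = (τ b).castSucc := by
  simp [permInsert]

theorem permInsert_bijective (n : ℕ) :
    Function.Bijective fun p : Fin (n + 1) × Equiv.Perm (Fin n) => permInsert p.1 p.2 := by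
  rw [Fintype.bijective_iff_injective_and_card]
  constructor
  · rintro ⟨a, τ⟩ ⟨b, ρ⟩ h
    dsimp only at h
    have hab : a = b := by
      apply (permInsert b ρ).injective
      rw [permInsert_self, ← h, permInsert_self]
    subst hab
    congr 1
    ext c
    have := congrArg (fun σ => σ (a.succAbove c)) h
    simp only [permInsert_succAbove] at this
    simpa using congrArg Fin.val this
  · simp [Fintype.card_perm, Nat.factorial_succ]

theorem inversionScalar_permInsert (q : ι → ι → 𝕜ˣ) {n : ℕ} (w : Fin (n + 1) → ι)
    (a : Fin (n + 1)) (τ : Equiv.Perm (Fin n)) :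
    inversionScalar q w (permInsert a τ) =
      (∏ b, if a < b then (q (w a) (w b) : 𝕜) else 1) *
        inversionScalar q (fun b => w (a.succAbove b)) τ := by
  rw [inversionScalar, Fin.prod_univ_succAbove _ a]
  congr 1
  · rw [Fin.prod_univ_succAbove _ a, Fin.prod_univ_succAbove _ a]
    simp [permInsert_self, permInsert_succAbove, Fin.castSucc_lt_last]
  · refine Finset.prod_congr rfl fun c _ => ?_
    rw [Fin.prod_univ_succAbove _ a]
    simp [permInsert_self, permInsert_succAbove, (Fin.castSucc_lt_last _).le]

theorem algebraMapInv_tAct (q : ι → ι → 𝕜ˣ) (i : ι) (x : FreeAlgebra 𝕜 ι) :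
    FreeAlgebra.algebraMapInv (tAct q i x) = (FreeAlgebra.algebraMapInv x : 𝕜) := by
  have : (FreeAlgebra.algebraMapInv (R := 𝕜)).comp (tAct q i) = FreeAlgebra.algebraMapInv := by
    ext k
    simp [tAct, FreeAlgebra.algebraMapInv]
  exact DFunLike.congr_fun this x

/-- Sorting the permutations of `n + 1` letters by the letter moved to the last position. -/
theorem symmWord_succ (q : ι → ι → 𝕜ˣ) {n : ℕ} (w : Fin (n + 1) → ι) :
    symmWord q w = ∑ a, (∏ b, if a < b then (q (w a) (w b) : 𝕜) else 1) •
      (symmWord q (fun b => w (a.succAbove b)) * FreeAlgebra.ι 𝕜 (w a)) := by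
  rw [symmWord, ← (permInsert_bijective n).sum_comp
    (fun σ => inversionScalar q w σ • word 𝕜 (fun a => w (σ.symm a))), Fintype.sum_prod_type]
  refine Finset.sum_congr rfl fun a _ => ?_
  rw [symmWord, Finset.sum_mul, Finset.smul_sum]
  refine Finset.sum_congr rfl fun τ _ => ?_
  have h1 : (permInsert a τ).symm (Fin.last n) = a := by
    rw [Equiv.symm_apply_eq, permInsert_self]
  have h2 : ∀ b : Fin n, (permInsert a τ).symm b.castSucc = a.succAbove (τ.symm b) := fun b => by
    rw [Equiv.symm_apply_eq, permInsert_succAbove, Equiv.apply_symm_apply]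
  rw [inversionScalar_permInsert, word_castSucc, smul_mul_assoc, smul_smul]
  simp only [h1, h2]

end Words

section Derivations

variable {𝕜 : Type*} [Field 𝕜] {ι : Type*} [DecidableEq ι]

/-- The algebra map `x ↦ !![x, ∂_i x; 0, g_i · x]`, whose multiplicativity encodes the skew Leibniz
rule `∂_i (x y) = x ∂_i y + (∂_i x) (g_i · y)`. -/
def tSkewMat (q : ι → ι → 𝕜ˣ) (i : ι) :
    FreeAlgebra 𝕜 ι →ₐ[𝕜] Matrix (Fin 2) (Fin 2) (FreeAlgebra 𝕜 ι) :=
  FreeAlgebra.lift 𝕜 fun j =>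
    !![FreeAlgebra.ι 𝕜 j, if j = i then 1 else 0; 0, (q i j : 𝕜) • FreeAlgebra.ι 𝕜 j]

/-- The skew derivation `∂_i` of `T(V)`. -/
def tDer (q : ι → ι → 𝕜ˣ) (i : ι) : FreeAlgebra 𝕜 ι →ₗ[𝕜] FreeAlgebra 𝕜 ι where
  toFun x := tSkewMat q i x 0 1
  map_add' x y := by simp
  map_smul' c x := by simp

theorem tSkewMat_apply (q : ι → ι → 𝕜ˣ) (i : ι) (x : FreeAlgebra 𝕜 ι) :
    tSkewMat q i x = !![x, tDer q i x; 0, tAct q i x] := by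
  have h : tSkewMat q i x 0 0 = x ∧ tSkewMat q i x 1 0 = 0 ∧ tSkewMat q i x 1 1 = tAct q i x := by
    induction x using FreeAlgebra.induction with
    | grade0 r => simp [Matrix.algebraMap_matrix_apply]
    | grade1 j => simp [tSkewMat, tAct]
    | mul x y hx hy =>
      simp [Matrix.mul_apply, Fin.sum_univ_two, hx, hy]
    | add x y hx hy => simp [hx, hy]
  ext a b
  fin_cases a <;> fin_cases b <;> simp [h, tDer]

theorem tDer_mul (q : ι → ι → 𝕜ˣ) (i : ι) (x y : FreeAlgebra 𝕜 ι) :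
    tDer q i (x * y) = x * tDer q i y + tDer q i x * tAct q i y := by
  change tSkewMat q i (x * y) 0 1 = _
  rw [map_mul, tSkewMat_apply, tSkewMat_apply]
  simp [Matrix.mul_apply, Fin.sum_univ_two]

theorem tDer_ι (q : ι → ι → 𝕜ˣ) (i j : ι) :
    tDer q i (FreeAlgebra.ι 𝕜 j) = if j = i then 1 else 0 := by
  change tSkewMat q i (FreeAlgebra.ι 𝕜 j) 0 1 = _
  simp [tSkewMat]

theorem tDer_algebraMap (q : ι → ι → 𝕜ˣ) (i : ι) (c : 𝕜) :
    tDer q i (algebraMap 𝕜 _ c) = 0 := by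
  change tSkewMat q i _ 0 1 = _
  simp [Matrix.algebraMap_matrix_apply]

theorem tDer_word (q : ι → ι → 𝕜ˣ) (i : ι) {n : ℕ} (w : Fin (n + 1) → ι) :
    tDer q i (word 𝕜 w) = ∑ a, if w a = i then
      (∏ b, if a < b then (q (w a) (w b) : 𝕜) else 1) • word 𝕜 (fun b => w (a.succAbove b))
      else 0 := by
  induction n with
  | zero =>
    rw [word_succ, word_zero, mul_one, tDer_ι, Fin.sum_univ_succ]
    simp [word_zero]
  | succ n ih =>
    rw [word_succ, tDer_mul, ih, tDer_ι, tAct_word, add_comm, Finset.mul_sum,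
      Fin.sum_univ_succ (n := n + 1)]
    congr 1
    · rw [Fin.prod_univ_succ (n := n + 1)]
      by_cases h : w 0 = i
      · simp only [h, one_mul, lt_irrefl, if_false, Fin.succ_pos, if_true]
        simp
      · simp [h]
    · refine Finset.sum_congr rfl fun a _ => ?_
      rw [Fin.prod_univ_succ (n := n + 1)]
      by_cases h : w a.succ = i
      · simp only [h, Fin.not_lt_zero, if_false, if_true, one_mul, Fin.succ_lt_succ_iff, word_succ,
          Fin.succ_succAbove_zero, Fin.succ_succAbove_succ, mul_smul_comm]
      · simp [h]

theorem tAct_tDer (q : ι → ι → 𝕜ˣ) (i j : ι) (x : FreeAlgebra 𝕜 ι) :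
    tDer q j (tAct q i x) = (q i j : 𝕜) • tAct q i (tDer q j x) := by
  induction x using FreeAlgebra.induction with
  | grade0 r => simp [tDer_algebraMap]
  | grade1 k =>
    simp only [tAct, FreeAlgebra.lift_ι_apply, map_smul, tDer_ι]
    by_cases h : k = j <;> simp [h]
  | mul x y hx hy =>
    have hc : tAct q j (tAct q i y) = tAct q i (tAct q j y) := by
      have : (tAct q j).comp (tAct q i) = (tAct q i).comp (tAct q j) := by
        ext k
        simp [tAct, smul_smul, mul_comm]
      exact DFunLike.congr_fun this y
    simp only [map_mul, tDer_mul, map_add, hx, hy, hc, smul_add, mul_smul_comm, smul_mul_assoc]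
  | add x y hx hy => simp [hx, hy]

end Derivations

section Radical

variable {𝕜 : Type*} [Field 𝕜] {ι : Type*} [DecidableEq ι] [Fintype ι]

/-- The factorisation `𝔖_n = (𝔖_{n-1} ⊗ id) T_n` of the quantum symmetrizer. -/
theorem quantumSymm_eq (q : ι → ι → 𝕜ˣ) (x : FreeAlgebra 𝕜 ι) :
    quantumSymm q x = algebraMap 𝕜 _ (FreeAlgebra.algebraMapInv x) +
      ∑ i, quantumSymm q (tDer q i x) * FreeAlgebra.ι 𝕜 i := by
  let R : FreeAlgebra 𝕜 ι →ₗ[𝕜] FreeAlgebra 𝕜 ι :=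
    (Algebra.linearMap 𝕜 _) ∘ₗ (FreeAlgebra.algebraMapInv (R := 𝕜) (X := ι)).toLinearMap +
      ∑ i, (LinearMap.mulRight 𝕜 (FreeAlgebra.ι 𝕜 i)) ∘ₗ quantumSymm q ∘ₗ tDer q i
  have h : quantumSymm q = R := by
    refine ext_word fun n w => ?_
    cases n with
    | zero =>
      have h1 := tDer_algebraMap q (ι := ι)
      simp only [R, quantumSymm_word]
      have h2 : ∀ i, tDer q i (1 : FreeAlgebra 𝕜 ι) = 0 := fun i => by
        simpa using tDer_algebraMap q i 1
      simp [word_zero, h2, symmWord, inversionScalar]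
    | succ n =>
      have h0 : FreeAlgebra.algebraMapInv (word 𝕜 w) = (0 : 𝕜) := by
        rw [word_succ, map_mul]
        simp [FreeAlgebra.algebraMapInv]
      simp only [R, quantumSymm_word, LinearMap.add_apply, LinearMap.comp_apply,
        AlgHom.toLinearMap_apply, h0, map_zero, zero_add, LinearMap.sum_apply, tDer_word, map_sum,
        LinearMap.mulRight_apply]
      rw [Finset.sum_comm, symmWord_succ]
      refine Finset.sum_congr rfl fun a _ => ?_
      rw [Finset.sum_eq_single (w a)]
      · simp [quantumSymm_word]
      · intro b _ hb
        simp [Ne.symm hb]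
      · simp
  have hx : quantumSymm q x = R x := by rw [h]
  rw [hx]
  simp only [R, LinearMap.add_apply, LinearMap.comp_apply, LinearMap.sum_apply,
    LinearMap.mulRight_apply, AlgHom.toLinearMap_apply, Algebra.linearMap_apply]

theorem mem_ker_iff (q : ι → ι → 𝕜ˣ) (x : FreeAlgebra 𝕜 ι) :
    quantumSymm q x = 0 ↔
      FreeAlgebra.algebraMapInv x = (0 : 𝕜) ∧ ∀ i, quantumSymm q (tDer q i x) = 0 := by
  constructor
  · intro h
    rw [quantumSymm_eq] at h
    constructor
    · have h1 := congrArg (FreeAlgebra.algebraMapInv (R := 𝕜)) h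
      simpa [FreeAlgebra.algebraMapInv] using h1
    · intro i
      -- stripping off a last letter `x_i`
      let D : FreeAlgebra 𝕜 ι →ₐ[𝕜] Matrix (Fin 2) (Fin 2) (FreeAlgebra 𝕜 ι) :=
        FreeAlgebra.lift 𝕜 fun j => !![FreeAlgebra.ι 𝕜 j, if j = i then 1 else 0; 0, 0]
      have hD : ∀ x, D x 0 0 = x := by
        intro x
        have : D x 0 0 = x ∧ D x 1 0 = 0 := by
          induction x using FreeAlgebra.induction with
          | grade0 r => simp [Matrix.algebraMap_matrix_apply]
          | grade1 j => simp [D]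
          | mul x y hx hy => simp [Matrix.mul_apply, Fin.sum_univ_two, hx, hy]
          | add x y hx hy => simp [hx, hy]
        exact this.1
      have h1 := congrArg (fun z => D z 0 1) h
      simpa [Matrix.algebraMap_matrix_apply, Matrix.sum_apply, Matrix.mul_apply,
        Fin.sum_univ_two, hD, D] using h1
  · rintro ⟨h0, h1⟩
    rw [quantumSymm_eq, h0]
    simp [h1]

/-- Coinduction principle: the kernel of the quantum symmetrizer is the largest family of elements
without constant term which is stable under all skew derivations. -/
theorem quantumSymm_eq_zero_of_stable (q : ι → ι → 𝕜ˣ) (W : Set (FreeAlgebra 𝕜 ι))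
    (h0 : ∀ x ∈ W, FreeAlgebra.algebraMapInv x = (0 : 𝕜)) (h1 : ∀ x ∈ W, ∀ i, tDer q i x ∈ W)
    (x : FreeAlgebra 𝕜 ι) (hx : x ∈ W) : quantumSymm q x = 0 := by
  let F : ℕ → Submodule 𝕜 (FreeAlgebra 𝕜 ι) := fun n =>
    Submodule.span 𝕜 {y | ∃ k < n, ∃ w : Fin k → ι, y = word 𝕜 w}
  have hF : ∀ n i, F (n + 1) ≤ (F n).comap (tDer q i) := by
    intro n i
    refine Submodule.span_le.2 ?_
    rintro _ ⟨k, hk, w, rfl⟩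
    rw [SetLike.mem_coe, Submodule.mem_comap]
    cases k with
    | zero =>
      have := tDer_algebraMap q i 1
      rw [map_one] at this
      rw [word_zero, this]
      exact zero_mem _
    | succ k =>
      rw [tDer_word]
      refine Submodule.sum_mem _ fun a _ => ?_
      split_ifs
      · exact Submodule.smul_mem _ _ (Submodule.subset_span ⟨k, by omega, _, rfl⟩)
      · exact zero_mem _
  have hex : ∃ n, x ∈ F n := by
    have hx' : x ∈ Submodule.span 𝕜 (Set.range (FreeAlgebra.basisFreeMonoid 𝕜 ι)) := by
      rw [Module.Basis.span_eq]; trivial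
    have hmono : Monotone F := fun a b hab =>
      Submodule.span_mono fun y ⟨k, hk, w, hw⟩ => ⟨k, lt_of_lt_of_le hk hab, w, hw⟩
    clear hx
    induction hx' using Submodule.span_induction with
    | mem y hy =>
      obtain ⟨l, rfl⟩ := hy
      exact ⟨_, Submodule.subset_span ⟨_, Nat.lt_succ_self _, _, basisFreeMonoid_eq_word l⟩⟩
    | zero => exact ⟨0, zero_mem _⟩
    | add y z _ _ hy hz =>
      obtain ⟨a, ha⟩ := hy
      obtain ⟨b, hb⟩ := hz
      exact ⟨max a b, add_mem (hmono (le_max_left _ _) ha) (hmono (le_max_right _ _) hb)⟩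
    | smul c y _ hy =>
      obtain ⟨a, ha⟩ := hy
      exact ⟨a, Submodule.smul_mem _ _ ha⟩
  obtain ⟨n, hn⟩ := hex
  induction n generalizing x with
  | zero =>
    have : x = 0 := by simpa [F] using hn
    rw [this, map_zero]
  | succ n ih =>
    rw [mem_ker_iff]
    exact ⟨h0 x hx, fun i => ih _ (h1 x hx i) (hF n i hn)⟩

theorem quantumSymm_tDer (q : ι → ι → 𝕜ˣ) (i : ι) {x : FreeAlgebra 𝕜 ι}
    (hx : quantumSymm q x = 0) : quantumSymm q (tDer q i x) = 0 :=
  ((mem_ker_iff q x).1 hx).2 i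

theorem quantumSymm_tAct (q : ι → ι → 𝕜ˣ) (i : ι) {x : FreeAlgebra 𝕜 ι}
    (hx : quantumSymm q x = 0) : quantumSymm q (tAct q i x) = 0 := by
  refine quantumSymm_eq_zero_of_stable q {y | ∃ x, quantumSymm q x = 0 ∧ y = tAct q i x} ?_ ?_ _
    ⟨x, hx, rfl⟩
  · rintro _ ⟨x, hx, rfl⟩
    rw [algebraMapInv_tAct, ((mem_ker_iff q x).1 hx).1]
  · rintro _ ⟨x, hx, rfl⟩ j
    refine ⟨(q i j : 𝕜) • tDer q j x, ?_, ?_⟩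
    · rw [map_smul, quantumSymm_tDer q j hx, smul_zero]
    · rw [tAct_tDer, map_smul]

theorem quantumSymm_mul_mul (q : ι → ι → 𝕜ˣ) (a b : FreeAlgebra 𝕜 ι) {x : FreeAlgebra 𝕜 ι}
    (hx : quantumSymm q x = 0) : quantumSymm q (a * x * b) = 0 := by
  let G : Set (FreeAlgebra 𝕜 ι) := {y | ∃ a x b, quantumSymm q x = 0 ∧ y = a * x * b}
  refine quantumSymm_eq_zero_of_stable q (Submodule.span 𝕜 G : Set (FreeAlgebra 𝕜 ι)) ?_ ?_ _
    (Submodule.subset_span ⟨a, x, b, hx, rfl⟩)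
  · intro y hy
    have : Submodule.span 𝕜 G ≤ LinearMap.ker (FreeAlgebra.algebraMapInv (R := 𝕜)).toLinearMap := by
      refine Submodule.span_le.2 ?_
      rintro _ ⟨a, x, b, hx, rfl⟩
      simp [((mem_ker_iff q x).1 hx).1]
    simpa using this hy
  · intro y hy i
    have : Submodule.span 𝕜 G ≤ (Submodule.span 𝕜 G).comap (tDer q i) := by
      refine Submodule.span_le.2 ?_
      rintro _ ⟨a, x, b, hx, rfl⟩
      rw [SetLike.mem_coe, Submodule.mem_comap, tDer_mul, tDer_mul, add_mul]
      exact add_mem (Submodule.subset_span ⟨a, x, _, hx, rfl⟩)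
        (add_mem (Submodule.subset_span ⟨a, _, _, quantumSymm_tDer q i hx, rfl⟩)
          (Submodule.subset_span ⟨_, _, _, quantumSymm_tAct q i hx, rfl⟩))
    exact this hy

/-- The defining ideal `𝒥(V) = ⨁_n ker 𝔖_n` of the Nichols algebra. -/
def nicholsIdeal (q : ι → ι → 𝕜ˣ) : Ideal (FreeAlgebra 𝕜 ι) where
  carrier := {x | quantumSymm q x = 0}
  add_mem' {x y} hx hy := by
    change quantumSymm q (x + y) = 0
    rw [map_add, show quantumSymm q x = 0 from hx, show quantumSymm q y = 0 from hy, add_zero]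
  zero_mem' := map_zero _
  smul_mem' a x hx := by
    change quantumSymm q (a * x) = 0
    simpa using quantumSymm_mul_mul q a 1 hx

theorem mem_nicholsIdeal (q : ι → ι → 𝕜ˣ) (x : FreeAlgebra 𝕜 ι) :
    x ∈ nicholsIdeal q ↔ quantumSymm q x = 0 := Iff.rfl

instance nicholsIdeal_isTwoSided (q : ι → ι → 𝕜ˣ) : (nicholsIdeal q).IsTwoSided where
  mul_mem_of_left {x} b hx := by
    rw [mem_nicholsIdeal] at hx ⊢
    simpa using quantumSymm_mul_mul q 1 b hx

/-- The Nichols algebra `ℬ(V) = T(V) / 𝒥(V)` of the braided vector space `V` of diagonal type with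
braiding matrix `q`. -/
abbrev NicholsAlgebra (q : ι → ι → 𝕜ˣ) : Type _ := FreeAlgebra 𝕜 ι ⧸ nicholsIdeal q

/-- The generators `x_i` of the Nichols algebra. -/
def gen (q : ι → ι → 𝕜ˣ) (i : ι) : NicholsAlgebra q :=
  Ideal.Quotient.mk (nicholsIdeal q) (FreeAlgebra.ι 𝕜 i)

/-- The action of `g_i = α_i` on the Nichols algebra, induced from `g_i · x_j = q i j x_j`. -/
def act (q : ι → ι → 𝕜ˣ) (i : ι) : NicholsAlgebra q →ₐ[𝕜] NicholsAlgebra q :=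
  Ideal.Quotient.liftₐ (nicholsIdeal q) ((Ideal.Quotient.mkₐ 𝕜 (nicholsIdeal q)).comp (tAct q i))
    fun x hx => by
      rw [AlgHom.comp_apply, Ideal.Quotient.mkₐ_eq_mk, Ideal.Quotient.eq_zero_iff_mem]
      exact quantumSymm_tAct q i hx

/-- The skew derivation `∂_i` of the Nichols algebra, induced by the skew derivation `∂_i` of the
tensor algebra. -/
def skewDer (q : ι → ι → 𝕜ˣ) (i : ι) : NicholsAlgebra q →ₗ[𝕜] NicholsAlgebra q :=
  (((nicholsIdeal q).restrictScalars 𝕜).liftQ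
    ((Ideal.Quotient.mkₐ 𝕜 (nicholsIdeal q)).toLinearMap ∘ₗ tDer q i) fun x hx => by
      rw [LinearMap.mem_ker, LinearMap.comp_apply, AlgHom.toLinearMap_apply,
        Ideal.Quotient.mkₐ_eq_mk, Ideal.Quotient.eq_zero_iff_mem]
      exact quantumSymm_tDer q i hx) ∘ₗ
    (Submodule.Quotient.restrictScalarsEquiv 𝕜 (nicholsIdeal q)).symm.toLinearMap

theorem act_mk (q : ι → ι → 𝕜ˣ) (i : ι) (x : FreeAlgebra 𝕜 ι) :
    act q i (Ideal.Quotient.mk (nicholsIdeal q) x) =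
      Ideal.Quotient.mk (nicholsIdeal q) (tAct q i x) := rfl

theorem skewDer_mk (q : ι → ι → 𝕜ˣ) (i : ι) (x : FreeAlgebra 𝕜 ι) :
    skewDer q i (Ideal.Quotient.mk (nicholsIdeal q) x) =
      Ideal.Quotient.mk (nicholsIdeal q) (tDer q i x) := rfl

theorem act_gen (q : ι → ι → 𝕜ˣ) (i j : ι) : act q i (gen q j) = (q i j : 𝕜) • gen q j := by
  rw [gen, act_mk, tAct, FreeAlgebra.lift_ι_apply]
  rfl

theorem skewDer_gen (q : ι → ι → 𝕜ˣ) (i j : ι) :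
    skewDer q i (gen q j) = if j = i then 1 else 0 := by
  rw [gen, skewDer_mk, tDer_ι]
  split_ifs <;> simp

theorem skewDer_mul (q : ι → ι → 𝕜ˣ) (i : ι) (x y : NicholsAlgebra q) :
    skewDer q i (x * y) = x * skewDer q i y + skewDer q i x * act q i y := by
  obtain ⟨x, rfl⟩ := Ideal.Quotient.mk_surjective x
  obtain ⟨y, rfl⟩ := Ideal.Quotient.mk_surjective y
  rw [← map_mul, skewDer_mk, tDer_mul, map_add, map_mul, map_mul, skewDer_mk, skewDer_mk, act_mk]

/-- The braided adjoint action `ad_c x_i (y) = x_i y - (g_i · y) x_i` of a generator. -/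
def adc (q : ι → ι → 𝕜ˣ) (i : ι) (y : NicholsAlgebra q) : NicholsAlgebra q :=
  gen q i * y - act q i y * gen q i

/-- The bicharacter on `ℤ^ι` with `bichar q α_i α_j = q i j`. -/
def bichar (q : ι → ι → 𝕜ˣ) (α β : ι → ℤ) : 𝕜ˣ :=
  ∏ i, ∏ j, q i j ^ (α i * β j)

end Radical

section RankTwo

variable {𝕜 : Type*} [Field 𝕜]

/-- The `q`-number `(n)_t = 1 + t + ⋯ + t^(n-1)`. -/
def qNum (t : 𝕜) (n : ℕ) : 𝕜 := ∑ j ∈ Finset.range n, t ^ j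

/-- The `q`-factorial `(n)_t^! = (1)_t (2)_t ⋯ (n)_t`. -/
def qFact (t : 𝕜) (n : ℕ) : 𝕜 := ∏ j ∈ Finset.range n, qNum t (j + 1)

/-! In rank two the indices `1, 2` of the basis `x_1, x_2` are `0, 1 : Fin 2`. -/

/-- `q̃_{12} = q_{12} q_{21}`. -/
def qTilde (q : Fin 2 → Fin 2 → 𝕜ˣ) : 𝕜 := q 0 1 * q 1 0

/-- `y_k = (ad_c x_1)^k x_2`. -/
def y (q : Fin 2 → Fin 2 → 𝕜ˣ) (k : ℕ) : NicholsAlgebra q := (adc q 0)^[k] (gen q 1)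

/-- `β_m = m α_1 + α_2`. -/
def β (m : ℕ) : Fin 2 → ℤ := ![m, 1]

/-- The scalar `q_{β_k, β_l}`. -/
def qβ (q : Fin 2 → Fin 2 → 𝕜ˣ) (k l : ℕ) : 𝕜 := bichar q (β k) (β l)

/-- `p_m = q_{β_m, β_m}`. -/
def p (q : Fin 2 → Fin 2 → 𝕜ˣ) (m : ℕ) : 𝕜 := qβ q m m

/-- `w_m = y_{m+2} y_m - q_{β_{m+2}, β_m} y_m y_{m+2}`. -/
def w (q : Fin 2 → Fin 2 → 𝕜ˣ) (m : ℕ) : NicholsAlgebra q :=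
  y q (m + 2) * y q m - qβ q (m + 2) m • (y q m * y q (m + 2))

/-- `w̃_m = w_m - q_{β_{m+1}, β_m} (m+2)_{q_{11}} (1 - q_{11}^{m+1} q̃_{12}) / (1 + p_{m+1}) y_{m+1}^2`,
considered for `p_{m+1} ≠ -1` only. -/
def wTilde (q : Fin 2 → Fin 2 → 𝕜ˣ) (m : ℕ) : NicholsAlgebra q :=
  w q m - (qβ q (m + 1) m * qNum (q 0 0 : 𝕜) (m + 2) *
    (1 - (q 0 0 : 𝕜) ^ (m + 1) * qTilde q) / (1 + p q (m + 1))) • y q (m + 1) ^ 2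

end RankTwo

end NicholsDiag

end

noncomputable section

namespace NicholsDiag

/-! ### Left skew derivations and the counit on the Nichols algebra. -/

section LeftDerivations

variable {𝕜 : Type*} [Field 𝕜] {ι : Type*}

/-! An element of `ℬ(V)` without constant term is zero once `∂_1` and `∂_2` kill it. Since `∂_1`
kills every `y_k`, it kills `w̃_m`, and the question is when `∂_2 w̃_m = 0`. As `∂_2 y_k` is a
multiple of `x_1^k`, `∂_2 w̃_m` is a combination of the `y_i x_1^j` with `i + j = 2m + 2` and `j ≤ m
+ 2`. The power `∂_1^n` reads off the coefficient of `x_1^n` in such a combination once the higher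
ones vanish (`mem_of_derPow_eq_zero`). The scalar in `w_m` removes the level `j = m + 2`, the scalar
in `w̃_m` the level `j = m + 1`, and `∂_1^m ∂_2 w̃_m` is the level `j = m`: an explicit multiple of
`y_{m+2}` (`derPow_wTilde`), which gives 3 ↔ 4.

For 3 → 2 the levels `j < m` must vanish as well. This uses the left skew derivation `d = leftDer q
0`, which commutes with all `∂_i` and sends `y_{k+1}` to a multiple of `y_k`. It is injective on
combinations in which only `y_i` with `i ≥ 1` occur (`eq_zero_of_leftDer`), so it suffices that `d
w̃_m = 0`. The relation for `w_{m-1}` (if `m > 0`) makes `d w̃_m` a combination of the braided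
commutator of `y_{m+1}, y_m` and of `y_m y_{m+1}` (`leftDer_wTilde`). Applying `∂_1^{m+1} ∂_2` and
`∂_1^m ∂_2` removes the second coefficient, and then either the first one or the commutator itself,
the latter by the same method one degree lower (`yComm_eq_zero`). -/

theorem tAct_comm (q r : ι → ι → 𝕜ˣ) (i j : ι) (x : FreeAlgebra 𝕜 ι) :
    tAct q i (tAct r j x) = tAct r j (tAct q i x) := by
  have : (tAct q i).comp (tAct r j) = (tAct r j).comp (tAct q i) := by
    ext k
    simp [tAct, smul_smul, mul_comm]
  exact DFunLike.congr_fun this x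

variable [DecidableEq ι]

/-- A skew derivation `∂_j` commutes up to a scalar with every diagonal automorphism of `T(V)`. -/
theorem tDer_tAct (q r : ι → ι → 𝕜ˣ) (i j : ι) (x : FreeAlgebra 𝕜 ι) :
    tDer q j (tAct r i x) = (r i j : 𝕜) • tAct r i (tDer q j x) := by
  induction x using FreeAlgebra.induction with
  | grade0 r => simp [tDer_algebraMap]
  | grade1 k =>
    simp only [tAct, FreeAlgebra.lift_ι_apply, map_smul, tDer_ι]
    by_cases h : k = j <;> simp [h]
  | mul x y hx hy =>
    simp only [map_mul, tDer_mul, map_add, hx, hy, tAct_comm q r, smul_add, mul_smul_comm,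
      smul_mul_assoc]
  | add x y hx hy => simp [hx, hy]

/-- The diagonal automorphism `x_j ↦ q j i x_j` of `T(V)`. -/
abbrev tCoact (q : ι → ι → 𝕜ˣ) (i : ι) : FreeAlgebra 𝕜 ι →ₐ[𝕜] FreeAlgebra 𝕜 ι :=
  tAct (fun a b => q b a) i

/-- The algebra map whose multiplicativity encodes the left skew Leibniz rule. -/
def tLeftMat (q : ι → ι → 𝕜ˣ) (i : ι) :
    FreeAlgebra 𝕜 ι →ₐ[𝕜] Matrix (Fin 2) (Fin 2) (FreeAlgebra 𝕜 ι) :=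
  FreeAlgebra.lift 𝕜 fun j =>
    !![(q j i : 𝕜) • FreeAlgebra.ι 𝕜 j, if j = i then 1 else 0; 0, FreeAlgebra.ι 𝕜 j]

/-- The left skew derivation of `T(V)`, which splits off a letter `x_i` on the left. -/
def tLeftDer (q : ι → ι → 𝕜ˣ) (i : ι) : FreeAlgebra 𝕜 ι →ₗ[𝕜] FreeAlgebra 𝕜 ι where
  toFun x := tLeftMat q i x 0 1
  map_add' x y := by simp
  map_smul' c x := by simp

theorem tLeftMat_apply (q : ι → ι → 𝕜ˣ) (i : ι) (x : FreeAlgebra 𝕜 ι) :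
    tLeftMat q i x = !![tCoact q i x, tLeftDer q i x; 0, x] := by
  have h : tLeftMat q i x 0 0 = tCoact q i x ∧ tLeftMat q i x 1 0 = 0 ∧
      tLeftMat q i x 1 1 = x := by
    induction x using FreeAlgebra.induction with
    | grade0 r => simp [Matrix.algebraMap_matrix_apply]
    | grade1 j => simp [tLeftMat, tAct]
    | mul x y hx hy =>
      simp [Matrix.mul_apply, Fin.sum_univ_two, hx, hy]
    | add x y hx hy => simp [hx, hy]
  ext a b
  fin_cases a <;> fin_cases b <;> simp [h, tLeftDer]

theorem tLeftDer_mul (q : ι → ι → 𝕜ˣ) (i : ι) (x y : FreeAlgebra 𝕜 ι) :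
    tLeftDer q i (x * y) = tLeftDer q i x * y + tCoact q i x * tLeftDer q i y := by
  change tLeftMat q i (x * y) 0 1 = _
  rw [map_mul, tLeftMat_apply, tLeftMat_apply]
  simp [Matrix.mul_apply, Fin.sum_univ_two, add_comm]

theorem tLeftDer_ι (q : ι → ι → 𝕜ˣ) (i j : ι) :
    tLeftDer q i (FreeAlgebra.ι 𝕜 j) = if j = i then 1 else 0 := by
  change tLeftMat q i (FreeAlgebra.ι 𝕜 j) 0 1 = _
  simp [tLeftMat]

theorem tLeftDer_algebraMap (q : ι → ι → 𝕜ˣ) (i : ι) (c : 𝕜) :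
    tLeftDer q i (algebraMap 𝕜 _ c) = 0 := by
  change tLeftMat q i _ 0 1 = _
  simp [Matrix.algebraMap_matrix_apply]

theorem tLeftDer_tAct (q r : ι → ι → 𝕜ˣ) (i j : ι) (x : FreeAlgebra 𝕜 ι) :
    tLeftDer q j (tAct r i x) = (r i j : 𝕜) • tAct r i (tLeftDer q j x) := by
  induction x using FreeAlgebra.induction with
  | grade0 r => simp [tLeftDer_algebraMap]
  | grade1 k =>
    simp only [tAct, FreeAlgebra.lift_ι_apply, map_smul, tLeftDer_ι]
    by_cases h : k = j <;> simp [h]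
  | mul x y hx hy =>
    simp only [map_mul, tLeftDer_mul, map_add, hx, hy, tAct_comm (fun a b => q b a) r, smul_add,
      mul_smul_comm, smul_mul_assoc]
  | add x y hx hy => simp [hx, hy]

/-- Splitting off a letter on the right and one on the left are independent. In the product case
both orders produce the same scalar `q i j` in the term where `∂_i` hits the left factor and the
left derivation hits the right one. -/
theorem tDer_tLeftDer (q : ι → ι → 𝕜ˣ) (i j : ι) (x : FreeAlgebra 𝕜 ι) :
    tDer q i (tLeftDer q j x) = tLeftDer q j (tDer q i x) := by
  have h1 : tDer q i (1 : FreeAlgebra 𝕜 ι) = 0 := by simpa using tDer_algebraMap q i 1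
  have h2 : tLeftDer q j (1 : FreeAlgebra 𝕜 ι) = 0 := by simpa using tLeftDer_algebraMap q j 1
  induction x using FreeAlgebra.induction with
  | grade0 r => simp [tLeftDer_algebraMap, tDer_algebraMap]
  | grade1 k =>
    rw [tDer_ι, tLeftDer_ι]
    split_ifs <;> simp [h1, h2]
  | mul x y hx hy =>
    simp only [tLeftDer_mul, tDer_mul, map_add, hx, hy, tDer_tAct, tLeftDer_tAct, mul_smul_comm,
      smul_mul_assoc]
    abel
  | add x y hx hy => simp [hx, hy]

theorem algebraMapInv_tLeftDer (q : ι → ι → 𝕜ˣ) (i : ι) (x : FreeAlgebra 𝕜 ι) :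
    FreeAlgebra.algebraMapInv (tLeftDer q i x) =
      (FreeAlgebra.algebraMapInv (tDer q i x) : 𝕜) := by
  induction x using FreeAlgebra.induction with
  | grade0 r => simp [tLeftDer_algebraMap, tDer_algebraMap]
  | grade1 k => rw [tDer_ι, tLeftDer_ι]
  | mul x y hx hy =>
    simp only [tLeftDer_mul, tDer_mul, map_add, map_mul, hx, hy, algebraMapInv_tAct]
    ring
  | add x y hx hy => simp [hx, hy]

variable [Fintype ι]

/-- The image of the kernel under the left derivation is stable under every `∂_j`, because the two
kinds of derivation commute; so the coinduction principle applies. -/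
theorem quantumSymm_tLeftDer (q : ι → ι → 𝕜ˣ) (i : ι) {x : FreeAlgebra 𝕜 ι}
    (hx : quantumSymm q x = 0) : quantumSymm q (tLeftDer q i x) = 0 := by
  refine quantumSymm_eq_zero_of_stable q {y | ∃ x, quantumSymm q x = 0 ∧ y = tLeftDer q i x}
    ?_ ?_ _ ⟨x, hx, rfl⟩
  · rintro _ ⟨x, hx, rfl⟩
    rw [algebraMapInv_tLeftDer, ((mem_ker_iff q _).1 (quantumSymm_tDer q i hx)).1]
  · rintro _ ⟨x, hx, rfl⟩ j
    exact ⟨tDer q j x, quantumSymm_tDer q j hx, tDer_tLeftDer q j i x⟩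

theorem quantumSymm_tAct_of (q r : ι → ι → 𝕜ˣ) (i : ι) {x : FreeAlgebra 𝕜 ι}
    (hx : quantumSymm q x = 0) : quantumSymm q (tAct r i x) = 0 := by
  refine quantumSymm_eq_zero_of_stable q {y | ∃ x, quantumSymm q x = 0 ∧ y = tAct r i x} ?_ ?_ _
    ⟨x, hx, rfl⟩
  · rintro _ ⟨x, hx, rfl⟩
    rw [algebraMapInv_tAct, ((mem_ker_iff q x).1 hx).1]
  · rintro _ ⟨x, hx, rfl⟩ j
    refine ⟨(r i j : 𝕜) • tDer q j x, ?_, ?_⟩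
    · rw [map_smul, quantumSymm_tDer q j hx, smul_zero]
    · rw [tDer_tAct, map_smul]

/-- The automorphism `x_j ↦ q j i x_j` of the Nichols algebra. -/
def coact (q : ι → ι → 𝕜ˣ) (i : ι) : NicholsAlgebra q →ₐ[𝕜] NicholsAlgebra q :=
  Ideal.Quotient.liftₐ (nicholsIdeal q)
    ((Ideal.Quotient.mkₐ 𝕜 (nicholsIdeal q)).comp (tCoact q i)) fun x hx => by
      rw [AlgHom.comp_apply, Ideal.Quotient.mkₐ_eq_mk, Ideal.Quotient.eq_zero_iff_mem]
      exact quantumSymm_tAct_of q _ i hx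

/-- The left skew derivation of the Nichols algebra. -/
def leftDer (q : ι → ι → 𝕜ˣ) (i : ι) : NicholsAlgebra q →ₗ[𝕜] NicholsAlgebra q :=
  (((nicholsIdeal q).restrictScalars 𝕜).liftQ
    ((Ideal.Quotient.mkₐ 𝕜 (nicholsIdeal q)).toLinearMap ∘ₗ tLeftDer q i) fun x hx => by
      rw [LinearMap.mem_ker, LinearMap.comp_apply, AlgHom.toLinearMap_apply,
        Ideal.Quotient.mkₐ_eq_mk, Ideal.Quotient.eq_zero_iff_mem]
      exact quantumSymm_tLeftDer q i hx) ∘ₗ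
    (Submodule.Quotient.restrictScalarsEquiv 𝕜 (nicholsIdeal q)).symm.toLinearMap

theorem coact_mk (q : ι → ι → 𝕜ˣ) (i : ι) (x : FreeAlgebra 𝕜 ι) :
    coact q i (Ideal.Quotient.mk (nicholsIdeal q) x) =
      Ideal.Quotient.mk (nicholsIdeal q) (tCoact q i x) := rfl

theorem leftDer_mk (q : ι → ι → 𝕜ˣ) (i : ι) (x : FreeAlgebra 𝕜 ι) :
    leftDer q i (Ideal.Quotient.mk (nicholsIdeal q) x) =
      Ideal.Quotient.mk (nicholsIdeal q) (tLeftDer q i x) := rfl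

theorem coact_gen (q : ι → ι → 𝕜ˣ) (i j : ι) : coact q i (gen q j) = (q j i : 𝕜) • gen q j := by
  rw [gen, coact_mk, tCoact, tAct, FreeAlgebra.lift_ι_apply]
  rfl

theorem leftDer_gen (q : ι → ι → 𝕜ˣ) (i j : ι) :
    leftDer q i (gen q j) = if j = i then 1 else 0 := by
  rw [gen, leftDer_mk, tLeftDer_ι]
  split_ifs <;> simp

theorem leftDer_mul (q : ι → ι → 𝕜ˣ) (i : ι) (x y : NicholsAlgebra q) :
    leftDer q i (x * y) = leftDer q i x * y + coact q i x * leftDer q i y := by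
  obtain ⟨x, rfl⟩ := Ideal.Quotient.mk_surjective x
  obtain ⟨y, rfl⟩ := Ideal.Quotient.mk_surjective y
  rw [← map_mul, leftDer_mk, tLeftDer_mul, map_add, map_mul, map_mul, leftDer_mk, leftDer_mk,
    coact_mk]

theorem skewDer_leftDer (q : ι → ι → 𝕜ˣ) (i j : ι) (x : NicholsAlgebra q) :
    skewDer q i (leftDer q j x) = leftDer q j (skewDer q i x) := by
  obtain ⟨x, rfl⟩ := Ideal.Quotient.mk_surjective x
  rw [leftDer_mk, skewDer_mk, skewDer_mk, leftDer_mk, tDer_tLeftDer]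

theorem skewDer_iterate_leftDer (q : ι → ι → 𝕜ˣ) (i j : ι) (n : ℕ) (x : NicholsAlgebra q) :
    (skewDer q i)^[n] (leftDer q j x) = leftDer q j ((skewDer q i)^[n] x) :=
  Function.Commute.iterate_left (skewDer_leftDer q i j) n x

/-- The counit of the Nichols algebra. -/
def counit (q : ι → ι → 𝕜ˣ) : NicholsAlgebra q →ₐ[𝕜] 𝕜 :=
  Ideal.Quotient.liftₐ (nicholsIdeal q) FreeAlgebra.algebraMapInv
    fun x hx => ((mem_ker_iff q x).1 hx).1

theorem counit_gen (q : ι → ι → 𝕜ˣ) (i : ι) : counit q (gen q i) = 0 := by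
  change FreeAlgebra.algebraMapInv (FreeAlgebra.ι 𝕜 i) = (0 : 𝕜)
  simp [FreeAlgebra.algebraMapInv]

/-- An element of the Nichols algebra without constant term vanishes as soon as all skew
derivations kill it. -/
theorem eq_zero_of_skewDer (q : ι → ι → 𝕜ˣ) {x : NicholsAlgebra q} (h0 : counit q x = 0)
    (h1 : ∀ i, skewDer q i x = 0) : x = 0 := by
  obtain ⟨x, rfl⟩ := Ideal.Quotient.mk_surjective x
  rw [Ideal.Quotient.eq_zero_iff_mem, mem_nicholsIdeal, mem_ker_iff]
  refine ⟨h0, fun i => ?_⟩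
  have := h1 i
  rwa [skewDer_mk, Ideal.Quotient.eq_zero_iff_mem] at this

end LeftDerivations

/-! ### The elements `y_k` and their derivatives. -/

section RankTwo

variable {𝕜 : Type*} [Field 𝕜]

theorem qNum_succ (t : 𝕜) (n : ℕ) : qNum t (n + 1) = qNum t n + t ^ n :=
  Finset.sum_range_succ _ _

theorem qNum_two (t : 𝕜) : qNum t 2 = 1 + t := by simp [qNum, Finset.sum_range_succ]

theorem qFact_zero (t : 𝕜) : qFact t 0 = 1 := by simp [qFact]

theorem qFact_succ (t : 𝕜) (n : ℕ) : qFact t (n + 1) = qFact t n * qNum t (n + 1) :=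
  Finset.prod_range_succ _ _

theorem qFact_one (t : 𝕜) : qFact t 1 = 1 := by simp [qFact, qNum]

theorem qFact_two (t : 𝕜) : qFact t 2 = 1 + t := by
  rw [qFact_succ, qFact_one, qNum_two, one_mul]

theorem qFact_ne_zero_of_le (t : 𝕜) {k n : ℕ} (h : k ≤ n) (hn : qFact t n ≠ 0) :
    qFact t k ≠ 0 := by
  rw [qFact, Finset.prod_ne_zero_iff] at *
  exact fun j hj => hn j (Finset.range_mono h hj)

variable (q : Fin 2 → Fin 2 → 𝕜ˣ)

/-- The coefficient of `x_1^k` in `∂_2 y_k`. -/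
def yCoeff (k : ℕ) : 𝕜 := ∏ j ∈ Finset.range k, (1 - (q 0 0 : 𝕜) ^ j * qTilde q)

theorem yCoeff_zero : yCoeff q 0 = 1 := by simp [yCoeff]

theorem yCoeff_succ (k : ℕ) :
    yCoeff q (k + 1) = yCoeff q k * (1 - (q 0 0 : 𝕜) ^ k * qTilde q) :=
  Finset.prod_range_succ _ _

theorem y_succ (k : ℕ) : y q (k + 1) = adc q 0 (y q k) := Function.iterate_succ_apply' _ _ _

theorem act_y (i : Fin 2) (k : ℕ) :
    act q i (y q k) = ((q i 0 : 𝕜) ^ k * q i 1) • y q k := by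
  induction k with
  | zero => simp [y, act_gen]
  | succ k ih =>
    have hc : act q i (act q 0 (y q k)) = act q 0 (act q i (y q k)) := by
      obtain ⟨z, hz⟩ := Ideal.Quotient.mk_surjective (y q k)
      rw [← hz, act_mk, act_mk, act_mk, act_mk, tAct_comm]
    rw [y_succ, adc, map_sub, map_mul, map_mul, hc, ih, act_gen, map_smul]
    simp only [smul_mul_assoc, mul_smul_comm, smul_smul, smul_sub]
    ring_nf

theorem coact_y (k : ℕ) :
    coact q 0 (y q k) = ((q 0 0 : 𝕜) ^ k * q 1 0) • y q k := by
  induction k with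
  | zero => simp [y, coact_gen]
  | succ k ih =>
    rw [y_succ, adc, act_y, map_sub, map_mul, map_mul, map_smul, ih, coact_gen]
    simp only [smul_mul_assoc, mul_smul_comm, smul_smul, smul_sub]
    ring_nf

theorem y_succ_eq (k : ℕ) : y q (k + 1) =
    gen q 0 * y q k - ((q 0 0 : 𝕜) ^ k * q 0 1) • (y q k * gen q 0) := by
  rw [y_succ, adc, act_y, smul_mul_assoc]

theorem gen_mul_y (k : ℕ) : gen q 0 * y q k =
    y q (k + 1) + ((q 0 0 : 𝕜) ^ k * q 0 1) • (y q k * gen q 0) := by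
  rw [y_succ_eq, sub_add_cancel]

theorem counit_y (k : ℕ) : counit q (y q k) = 0 := by
  induction k with
  | zero => exact counit_gen q 1
  | succ k ih => simp [y_succ_eq, ih]

theorem skewDer_one (i : Fin 2) : skewDer q i 1 = 0 := by
  have := skewDer_mul q i 1 1
  simpa using this

/-- The braiding in `ad_c x_1` makes the two terms in which `∂_1` hits `x_1` cancel. -/
theorem skewDer_zero_y (k : ℕ) : skewDer q 0 (y q k) = 0 := by
  induction k with
  | zero => simp [y, skewDer_gen]
  | succ k ih =>
    rw [y_succ_eq, map_sub, map_smul, skewDer_mul, skewDer_mul, ih, act_y, skewDer_gen]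
    simp

theorem act_gen_pow (i : Fin 2) (k : ℕ) :
    act q i (gen q 0 ^ k) = (q i 0 : 𝕜) ^ k • gen q 0 ^ k := by
  rw [map_pow, act_gen, smul_pow]

theorem skewDer_one_y (k : ℕ) : skewDer q 1 (y q k) = yCoeff q k • gen q 0 ^ k := by
  induction k with
  | zero => simp [y, skewDer_gen, yCoeff_zero]
  | succ k ih =>
    rw [y_succ_eq, map_sub, map_smul, skewDer_mul, skewDer_mul, ih, act_gen, skewDer_gen,
      yCoeff_succ, qTilde]
    simp only [smul_mul_assoc, mul_smul_comm, ← pow_succ, ← pow_succ', smul_smul, zero_ne_one,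
      if_false, mul_zero, zero_mul, zero_add, add_zero, ← sub_smul]
    congr 1
    ring

theorem skewDer_zero_gen_pow (k : ℕ) :
    skewDer q 0 (gen q 0 ^ (k + 1)) = qNum (q 0 0 : 𝕜) (k + 1) • gen q 0 ^ k := by
  induction k with
  | zero => simp [skewDer_gen, qNum]
  | succ k ih =>
    rw [pow_succ', skewDer_mul, ih, act_gen_pow, skewDer_gen, qNum_succ _ (k + 1), add_smul,
      mul_smul_comm, ← pow_succ']
    simp

theorem skewDer_one_gen_pow (k : ℕ) : skewDer q 1 (gen q 0 ^ k) = 0 := by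
  induction k with
  | zero => simp [skewDer_one]
  | succ k ih => rw [pow_succ', skewDer_mul, ih, skewDer_gen]; simp

/-- The scalar relating `y_k` to the image of `y_{k+1}` under the left skew derivation. -/
def yLower (k : ℕ) : 𝕜 := qNum (q 0 0 : 𝕜) (k + 1) * (1 - (q 0 0 : 𝕜) ^ k * qTilde q)

theorem leftDer_y_zero : leftDer q 0 (y q 0) = 0 := by simp [y, leftDer_gen]

/-- The recursion produced by the Leibniz rule in `leftDer_y`: removing the outer `x_1` contributes
the first two terms, and `x_1 y_k`, rewritten by `gen_mul_y`, the last. -/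
theorem yLower_succ (k : ℕ) : yLower q (k + 1) =
    1 - (q 0 0 : 𝕜) ^ (2 * (k + 1)) * qTilde q + q 0 0 * yLower q k := by
  have h : qNum (q 0 0 : 𝕜) (k + 1) = 1 + q 0 0 * qNum (q 0 0 : 𝕜) k := by
    rw [qNum, Finset.sum_range_succ', qNum, Finset.mul_sum]
    simp [pow_succ', add_comm]
  have h' : qNum (q 0 0 : 𝕜) (k + 2) = 1 + q 0 0 * qNum (q 0 0 : 𝕜) (k + 1) := by
    rw [qNum, Finset.sum_range_succ', qNum, Finset.mul_sum]
    simp [pow_succ', add_comm]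
  have h2 := qNum_succ (q 0 0 : 𝕜) (k + 1)
  rw [yLower, yLower]
  rw [h'] at h2 ⊢
  linear_combination (- (q 0 0 : 𝕜) ^ (k + 1) * qTilde q) * h2

theorem leftDer_y (k : ℕ) : leftDer q 0 (y q (k + 1)) = yLower q k • y q k := by
  induction k with
  | zero =>
    rw [y_succ_eq, map_sub, map_smul, leftDer_mul, leftDer_mul, leftDer_y_zero, coact_y,
      leftDer_gen, yLower, qTilde, qNum]
    simp [sub_smul, smul_smul]
  | succ k ih =>
    rw [y_succ_eq, map_sub, map_smul, leftDer_mul, leftDer_mul, ih, coact_y, leftDer_gen,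
      coact_gen, yLower_succ]
    simp only [if_true, one_mul, smul_mul_assoc, mul_smul_comm, gen_mul_y, mul_one, smul_add,
      smul_smul, add_smul, sub_smul, one_smul, qTilde]
    module

theorem gen_pow_eq_zero {k : ℕ} (h : qFact (q 0 0 : 𝕜) k = 0) : gen q 0 ^ k = 0 := by
  induction k with
  | zero => simp [qFact_zero] at h
  | succ k ih =>
    refine eq_zero_of_skewDer q (by simp [counit_gen]) fun i => ?_
    fin_cases i
    · change skewDer q 0 _ = 0
      rw [skewDer_zero_gen_pow]
      rw [qFact_succ, mul_eq_zero] at h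
      rcases h with h | h <;> simp [h, ih]
    · exact skewDer_one_gen_pow q _

/-- Used contrapositively: `y_k ≠ 0` makes the `q`-factorials and the coefficients of `∂_2 y_k`
invertible. -/
theorem y_eq_zero {k : ℕ} (h : qFact (q 0 0 : 𝕜) k = 0 ∨ yCoeff q k = 0) : y q k = 0 := by
  refine eq_zero_of_skewDer q (counit_y q k) fun i => ?_
  fin_cases i
  · exact skewDer_zero_y q k
  · change skewDer q 1 _ = 0
    rw [skewDer_one_y]
    rcases h with h | h
    · rw [gen_pow_eq_zero q h, smul_zero]
    · rw [h, zero_smul]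

theorem y_succ_eq_zero {k : ℕ} (h : y q k = 0) : y q (k + 1) = 0 := by
  simp [y_succ_eq, h]

/-- The two factors of `yLower q k` are the last factors of `(k+1)!` and of `yCoeff q (k + 1)`, so a
single left derivative detects whether `y_{k+1}` vanishes. -/
theorem y_succ_eq_zero_of_leftDer {k : ℕ} (h : yLower q k • y q k = 0) : y q (k + 1) = 0 := by
  rcases smul_eq_zero.1 h with h | h
  · apply y_eq_zero
    rw [qFact_succ, yCoeff_succ]
    rcases mul_eq_zero.1 h with h | h <;> simp [h]
  · exact y_succ_eq_zero q h

/-! ### Powers of `∂_1` on `y_b x_1^a` and `x_1^a y_b`. -/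

/-- The powers of the skew derivation `∂_1`. -/
abbrev derPow (n : ℕ) : Module.End 𝕜 (NicholsAlgebra q) := skewDer q 0 ^ n

theorem derPow_succ (n : ℕ) (z : NicholsAlgebra q) :
    derPow q (n + 1) z = derPow q n (skewDer q 0 z) := by
  rw [derPow, pow_succ, Module.End.mul_apply]

theorem derPow_leftDer (n : ℕ) (z : NicholsAlgebra q) :
    derPow q n (leftDer q 0 z) = leftDer q 0 (derPow q n z) := by
  rw [derPow, Module.End.pow_apply, Module.End.pow_apply, skewDer_iterate_leftDer]

theorem skewDer_y_mul_gen_pow (b a : ℕ) : skewDer q 0 (y q b * gen q 0 ^ (a + 1)) =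
    qNum (q 0 0 : 𝕜) (a + 1) • (y q b * gen q 0 ^ a) := by
  rw [skewDer_mul, skewDer_zero_y, skewDer_zero_gen_pow, zero_mul, add_zero, mul_smul_comm]

theorem skewDer_gen_pow_mul_y (b a : ℕ) : skewDer q 0 (gen q 0 ^ (a + 1) * y q b) =
    (qNum (q 0 0 : 𝕜) (a + 1) * ((q 0 0 : 𝕜) ^ b * q 0 1)) • (gen q 0 ^ a * y q b) := by
  rw [skewDer_mul, skewDer_zero_y, skewDer_zero_gen_pow, act_y, mul_zero, zero_add,
    smul_mul_assoc, mul_smul_comm, smul_smul]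

/-- The true coefficient is `(a+n)! / a!`; multiplying by `a!` avoids assuming it invertible. -/
theorem qFact_smul_derPow_y_mul (b a n : ℕ) :
    qFact (q 0 0 : 𝕜) a • derPow q n (y q b * gen q 0 ^ (a + n)) =
      qFact (q 0 0 : 𝕜) (a + n) • (y q b * gen q 0 ^ a) := by
  induction n with
  | zero => simp
  | succ n ih =>
    rw [derPow_succ, ← add_assoc, skewDer_y_mul_gen_pow, map_smul, smul_comm, ih, smul_smul,
      qFact_succ, mul_comm]

theorem qFact_smul_derPow_mul_y (b a n : ℕ) :
    qFact (q 0 0 : 𝕜) a • derPow q n (gen q 0 ^ (a + n) * y q b) =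
      (qFact (q 0 0 : 𝕜) (a + n) * ((q 0 0 : 𝕜) ^ b * q 0 1) ^ n) • (gen q 0 ^ a * y q b) := by
  induction n with
  | zero => simp
  | succ n ih =>
    rw [derPow_succ, ← add_assoc, skewDer_gen_pow_mul_y, map_smul, smul_comm, ih, smul_smul,
      qFact_succ]
    ring_nf

theorem derPow_y_mul_self (b n : ℕ) :
    derPow q n (y q b * gen q 0 ^ n) = qFact (q 0 0 : 𝕜) n • y q b := by
  simpa [qFact_zero] using qFact_smul_derPow_y_mul q b 0 n

theorem derPow_mul_y_self (b n : ℕ) : derPow q n (gen q 0 ^ n * y q b) =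
    (qFact (q 0 0 : 𝕜) n * ((q 0 0 : 𝕜) ^ b * q 0 1) ^ n) • y q b := by
  simpa [qFact_zero] using qFact_smul_derPow_mul_y q b 0 n

theorem derPow_y_mul_eq_zero (b : ℕ) {a n : ℕ} (h : a < n) :
    derPow q n (y q b * gen q 0 ^ a) = 0 := by
  obtain ⟨k, rfl⟩ := Nat.exists_eq_add_of_lt h
  rw [show a + k + 1 = k + 1 + a by ring, derPow, pow_add, Module.End.mul_apply,
    derPow_y_mul_self, map_smul, derPow_succ, skewDer_zero_y, map_zero, smul_zero]

theorem derPow_mul_y_eq_zero (b : ℕ) {a n : ℕ} (h : a < n) :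
    derPow q n (gen q 0 ^ a * y q b) = 0 := by
  obtain ⟨k, rfl⟩ := Nat.exists_eq_add_of_lt h
  rw [show a + k + 1 = k + 1 + a by ring, derPow, pow_add, Module.End.mul_apply,
    derPow_mul_y_self, map_smul, derPow_succ, skewDer_zero_y, map_zero, smul_zero]

/-! ### The filtration by powers of `x_1`, and injectivity of the left derivation. -/

/-- The span of the `y_i x_1^j` of degree `i + j = N` in `x_1` with `j < n`. -/
def genFiltration (N n : ℕ) : Submodule 𝕜 (NicholsAlgebra q) :=
  Submodule.span 𝕜 {z | ∃ i j, i + j = N ∧ j < n ∧ z = y q i * gen q 0 ^ j}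

theorem y_mul_gen_pow_mem {i j N n : ℕ} (h : i + j = N) (hj : j < n) :
    y q i * gen q 0 ^ j ∈ genFiltration q N n :=
  Submodule.subset_span ⟨i, j, h, hj, rfl⟩

theorem gen_mul_mem {N n : ℕ} {z : NicholsAlgebra q} (hz : z ∈ genFiltration q N n) :
    gen q 0 * z ∈ genFiltration q (N + 1) (n + 1) := by
  have : genFiltration q N n ≤
      (genFiltration q (N + 1) (n + 1)).comap (LinearMap.mulLeft 𝕜 (gen q 0)) := by
    refine Submodule.span_le.2 ?_
    rintro _ ⟨i, j, rfl, hj, rfl⟩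
    rw [SetLike.mem_coe, Submodule.mem_comap, LinearMap.mulLeft_apply, ← mul_assoc, gen_mul_y,
      add_mul, smul_mul_assoc, mul_assoc, ← pow_succ']
    exact add_mem (y_mul_gen_pow_mem q (by ring) (by omega))
      (Submodule.smul_mem _ _ (y_mul_gen_pow_mem q (by ring) (by omega)))
  exact this hz

theorem gen_pow_mul_y_mem (a b : ℕ) :
    gen q 0 ^ a * y q b ∈ genFiltration q (a + b) (a + 1) := by
  induction a with
  | zero => simpa using y_mul_gen_pow_mem q (i := b) (j := 0) (N := b) (n := 1) rfl one_pos
  | succ a ih =>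
    have := gen_mul_mem q ih
    rwa [← mul_assoc, ← pow_succ', show a + b + 1 = a + 1 + b by ring] at this

theorem genFiltration_mono (N : ℕ) {n n' : ℕ} (h : n ≤ n') :
    genFiltration q N n ≤ genFiltration q N n' :=
  Submodule.span_mono fun _ ⟨i, j, hN, hj, hz⟩ => ⟨i, j, hN, hj.trans_le h, hz⟩

theorem derPow_eq_zero_of_mem {N n : ℕ} {z : NicholsAlgebra q} (hz : z ∈ genFiltration q N n) :
    derPow q n z = 0 := by
  have : genFiltration q N n ≤ LinearMap.ker (derPow q n) := by
    refine Submodule.span_le.2 ?_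
    rintro _ ⟨i, j, -, hj, rfl⟩
    exact derPow_y_mul_eq_zero q i hj
  exact this hz

theorem exists_sub_mem {b n : ℕ} {z : NicholsAlgebra q}
    (hz : z ∈ genFiltration q (b + n) (n + 1)) :
    ∃ c : 𝕜, z - c • (y q b * gen q 0 ^ n) ∈ genFiltration q (b + n) n := by
  induction hz using Submodule.span_induction with
  | mem z hz =>
    obtain ⟨i, j, hN, hj, rfl⟩ := hz
    rcases Nat.lt_succ_iff_lt_or_eq.1 hj with hj | rfl
    · exact ⟨0, by simpa using y_mul_gen_pow_mem q hN hj⟩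
    · obtain rfl : i = b := by omega
      exact ⟨1, by simp⟩
  | zero => exact ⟨0, by simp⟩
  | add z z' _ _ hz hz' =>
    obtain ⟨c, hc⟩ := hz
    obtain ⟨c', hc'⟩ := hz'
    refine ⟨c + c', ?_⟩
    convert add_mem hc hc' using 1
    module
  | smul a z _ hz =>
    obtain ⟨c, hc⟩ := hz
    refine ⟨a * c, ?_⟩
    convert Submodule.smul_mem _ a hc using 1
    module

/-- If `c` is the coefficient of `y_b x_1^n`, then `∂_1^n z = c n! y_b`. Its vanishing gives `c y_b
= 0`, so the top term is zero even when `c` is not. -/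
theorem mem_of_derPow_eq_zero {b n : ℕ} (hn : qFact (q 0 0 : 𝕜) n ≠ 0) {z : NicholsAlgebra q}
    (hz : z ∈ genFiltration q (b + n) (n + 1)) (h : derPow q n z = 0) :
    z ∈ genFiltration q (b + n) n := by
  obtain ⟨c, hc⟩ := exists_sub_mem q hz
  have h' := derPow_eq_zero_of_mem q hc
  rw [map_sub, h, map_smul, derPow_y_mul_self, zero_sub, neg_eq_zero, smul_comm,
    smul_eq_zero_iff_right hn] at h'
  rwa [← smul_mul_assoc, h', zero_mul, sub_zero] at hc

/-- On the span of the `y_i x_1^j` with `i ≠ 0` and `j` small, the left skew derivation has no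
kernel. -/
theorem eq_zero_of_leftDer {N n : ℕ} (hN : n ≤ N) (hn : qFact (q 0 0 : 𝕜) n ≠ 0)
    {z : NicholsAlgebra q} (hz : z ∈ genFiltration q N n) (h : leftDer q 0 z = 0) : z = 0 := by
  induction n with
  | zero => simpa [genFiltration] using hz
  | succ n ih =>
    have hn' := qFact_ne_zero_of_le _ n.le_succ hn
    refine ih (by omega) hn' ?_
    -- The bound `n + 1 ≤ N` makes the top term a multiple of `y_{b+1} x_1^n`, with positive index,
    -- so that `leftDer_y` applies.
    obtain ⟨b, rfl⟩ : ∃ b, N = b + 1 + n := ⟨N - (n + 1), by omega⟩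
    refine mem_of_derPow_eq_zero q hn' hz ?_
    obtain ⟨c, hc⟩ := exists_sub_mem q hz
    have h' := derPow_eq_zero_of_mem q hc
    rw [map_sub, map_smul, derPow_y_mul_self, sub_eq_zero] at h'
    -- Commuting `∂_1^n` with the left derivation turns the hypothesis into `c n! yLower_b y_b = 0`;
    -- hence `c = 0` or `y_{b+1} = 0`.
    have h2 := derPow_leftDer q n z
    rw [h, map_zero, h', map_smul, map_smul, leftDer_y, smul_comm, eq_comm, smul_comm c,
      smul_comm (yLower q b)] at h2
    rw [h']
    rcases eq_or_ne c 0 with rfl | hc0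
    · simp
    · rw [smul_eq_zero_iff_right hn', smul_eq_zero_iff_right hc0] at h2
      rw [y_succ_eq_zero_of_leftDer q h2, smul_zero, smul_zero]

/-! ### Derivatives of the products `y_a y_b`. -/

theorem skewDer_y_mul_y (a b : ℕ) : skewDer q 1 (y q a * y q b) =
    yCoeff q b • (y q a * gen q 0 ^ b) +
      (yCoeff q a * ((q 1 0 : 𝕜) ^ b * q 1 1)) • (gen q 0 ^ a * y q b) := by
  rw [skewDer_mul, skewDer_one_y, skewDer_one_y, act_y, mul_smul_comm, smul_mul_assoc,
    mul_smul_comm, smul_smul]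

theorem skewDer_y_mul_y_mem (a b : ℕ) :
    skewDer q 1 (y q a * y q b) ∈ genFiltration q (a + b) (max a b + 1) := by
  rw [skewDer_y_mul_y]
  refine add_mem (Submodule.smul_mem _ _ (y_mul_gen_pow_mem q rfl (by omega)))
    (Submodule.smul_mem _ _ (genFiltration_mono q _ (by omega) (gen_pow_mul_y_mem q a b)))

theorem leftDer_y_mul_y (a b : ℕ) : leftDer q 0 (y q (a + 1) * y q (b + 1)) =
    yLower q a • (y q a * y q (b + 1)) +
      ((q 0 0 : 𝕜) ^ (a + 1) * q 1 0 * yLower q b) • (y q (a + 1) * y q b) := by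
  rw [leftDer_mul, leftDer_y, leftDer_y, coact_y, smul_mul_assoc, smul_mul_assoc, mul_smul_comm,
    smul_smul]

theorem leftDer_y_mul_y_zero (a : ℕ) : leftDer q 0 (y q (a + 1) * y q 0) =
    yLower q a • (y q a * y q 0) := by
  rw [leftDer_mul, leftDer_y, leftDer_y_zero, smul_mul_assoc, mul_zero, add_zero]

theorem leftDer_y_zero_mul_y (b : ℕ) : leftDer q 0 (y q 0 * y q (b + 1)) =
      ((q 1 0 : 𝕜) * yLower q b) • (y q 0 * y q b) := by
  rw [leftDer_mul, leftDer_y, leftDer_y_zero, coact_y, zero_mul, zero_add, smul_mul_assoc,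
    mul_smul_comm, smul_smul, pow_zero, one_mul]

/-- The braided Leibniz rule for `ad_c x_1`. -/
theorem adc_y_mul_y (a b : ℕ) : adc q 0 (y q a * y q b) =
    y q (a + 1) * y q b + ((q 0 0 : 𝕜) ^ a * q 0 1) • (y q a * y q (b + 1)) := by
  rw [adc, map_mul, act_y, act_y, ← mul_assoc, gen_mul_y, y_succ_eq q b]
  simp only [add_mul, mul_sub, smul_mul_assoc, mul_smul_comm, mul_assoc, smul_smul]
  module

theorem adc_add (z z' : NicholsAlgebra q) : adc q 0 (z + z') = adc q 0 z + adc q 0 z' := by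
  rw [adc, adc, adc, map_add, mul_add, add_mul]
  abel

theorem adc_smul (c : 𝕜) (z : NicholsAlgebra q) : adc q 0 (c • z) = c • adc q 0 z := by
  rw [adc, adc, map_smul, mul_smul_comm, smul_mul_assoc, smul_sub]

/-- `q_{β_k, β_l}` in terms of the braiding matrix. -/
theorem qβ_eq (k l : ℕ) : qβ q k l =
    (q 0 0 : 𝕜) ^ (k * l) * (q 0 1 : 𝕜) ^ k * (q 1 0 : 𝕜) ^ l * q 1 1 := by
  simp only [qβ, bichar, β, Fin.prod_univ_two]
  have h (a : 𝕜ˣ) (k l : ℕ) : a ^ ((k : ℤ) * l) = a ^ (k * l) := by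
    rw [← Nat.cast_mul, zpow_natCast]
  simp [h]
  ring

theorem p_eq (k : ℕ) : p q k = (q 0 0 : 𝕜) ^ (k * k) * qTilde q ^ k * q 1 1 := by
  rw [p, qβ_eq, qTilde]
  ring

theorem derPow_skewDer_y_mul_y (n a b : ℕ) : derPow q n (skewDer q 1 (y q a * y q b)) =
    yCoeff q b • derPow q n (y q a * gen q 0 ^ b) +
      (yCoeff q a * ((q 1 0 : 𝕜) ^ b * q 1 1)) • derPow q n (gen q 0 ^ a * y q b) := by
  rw [skewDer_y_mul_y, map_add, map_smul, map_smul]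

theorem derPow_gen_pow_succ_mul_y (b n : ℕ) :
    derPow q n (gen q 0 ^ (n + 1) * y q b) =
      (qFact (q 0 0 : 𝕜) (n + 1) * ((q 0 0 : 𝕜) ^ b * q 0 1) ^ n) • (gen q 0 * y q b) := by
  have := qFact_smul_derPow_mul_y q b 1 n
  rwa [qFact_one, one_smul, pow_one, add_comm 1 n] at this

theorem derPow_y_mul_gen_pow_succ (b n : ℕ) :
    derPow q n (y q b * gen q 0 ^ (n + 1)) =
      qFact (q 0 0 : 𝕜) (n + 1) • (y q b * gen q 0) := by
  have := qFact_smul_derPow_y_mul q b 1 n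
  rwa [qFact_one, one_smul, pow_one, add_comm 1 n] at this

theorem derPow_gen_pow_add_two_mul_y (b n : ℕ) :
    (1 + (q 0 0 : 𝕜)) • derPow q n (gen q 0 ^ (n + 2) * y q b) =
      (qFact (q 0 0 : 𝕜) (n + 2) * ((q 0 0 : 𝕜) ^ b * q 0 1) ^ n) •
        (gen q 0 ^ 2 * y q b) := by
  have := qFact_smul_derPow_mul_y q b 2 n
  rwa [qFact_two, add_comm 2 n] at this

theorem derPow_y_mul_gen_pow_add_two (b n : ℕ) :
    (1 + (q 0 0 : 𝕜)) • derPow q n (y q b * gen q 0 ^ (n + 2)) =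
      qFact (q 0 0 : 𝕜) (n + 2) • (y q b * gen q 0 ^ 2) := by
  have := qFact_smul_derPow_y_mul q b 2 n
  rwa [qFact_two, add_comm 2 n] at this

theorem gen_sq_mul_y (b : ℕ) : gen q 0 ^ 2 * y q b = y q (b + 2) +
    ((1 + (q 0 0 : 𝕜)) * ((q 0 0 : 𝕜) ^ b * q 0 1)) • (y q (b + 1) * gen q 0) +
      ((q 0 0 : 𝕜) ^ b * q 0 1) ^ 2 • (y q b * gen q 0 ^ 2) := by
  rw [pow_two, mul_assoc, gen_mul_y, mul_add, gen_mul_y, mul_smul_comm, ← mul_assoc, gen_mul_y,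
    add_mul, smul_mul_assoc, mul_assoc]
  module

/-! ### Leading coefficients of `∂_2` on `w_k`, `y_k^2` and `w̃_m`. -/

theorem derPow_succ_w (k : ℕ) : derPow q (k + 1) (skewDer q 1 (w q k)) =
    (qFact (q 0 0 : 𝕜) (k + 2) * yCoeff q (k + 2) * ((q 1 0 : 𝕜) ^ k * q 1 1) *
      ((q 0 0 : 𝕜) ^ k * q 0 1) ^ (k + 1)) • y q (k + 1) := by
  rw [w, map_sub, map_smul, map_sub, map_smul, derPow_skewDer_y_mul_y, derPow_skewDer_y_mul_y,
    derPow_y_mul_eq_zero q _ k.lt_succ_self, derPow_mul_y_eq_zero q _ k.lt_succ_self,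
    derPow_gen_pow_succ_mul_y, derPow_y_mul_gen_pow_succ, gen_mul_y, qβ_eq]
  match_scalars <;> ring

/-- The scalar `q_{β_{k+2} β_k}` in `w_k` is the one for which the two terms at level `k + 2`
cancel. -/
theorem derPow_add_two_w (k : ℕ) : derPow q (k + 2) (skewDer q 1 (w q k)) = 0 := by
  have h : k < k + 2 := by omega
  rw [w, map_sub, map_smul, map_sub, map_smul, derPow_skewDer_y_mul_y, derPow_skewDer_y_mul_y,
    derPow_y_mul_eq_zero q _ h, derPow_mul_y_eq_zero q _ h,
    derPow_mul_y_self, derPow_y_mul_self, qβ_eq]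
  match_scalars
  ring

theorem derPow_sq (k : ℕ) : derPow q k (skewDer q 1 (y q k ^ 2)) =
    (qFact (q 0 0 : 𝕜) k * yCoeff q k * (1 + p q k)) • y q k := by
  rw [pow_two, derPow_skewDer_y_mul_y, derPow_mul_y_self, derPow_y_mul_self, p_eq, qTilde]
  match_scalars
  ring

theorem derPow_succ_sq (k : ℕ) : derPow q (k + 1) (skewDer q 1 (y q k ^ 2)) = 0 := by
  rw [pow_two, derPow_skewDer_y_mul_y, derPow_y_mul_eq_zero q _ k.lt_succ_self,
    derPow_mul_y_eq_zero q _ k.lt_succ_self, smul_zero, smul_zero, add_zero]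

theorem qFact_ne_zero {k : ℕ} (h : y q k ≠ 0) : qFact (q 0 0 : 𝕜) k ≠ 0 :=
  fun h' => h (y_eq_zero q (.inl h'))

theorem yCoeff_ne_zero {k : ℕ} (h : y q k ≠ 0) : yCoeff q k ≠ 0 :=
  fun h' => h (y_eq_zero q (.inr h'))

theorem y_ne_zero_of_le {k n : ℕ} (h : k ≤ n) (hn : y q n ≠ 0) : y q k ≠ 0 := by
  induction n, h using Nat.le_induction with
  | base => exact hn
  | succ n _ ih => exact ih fun h' => hn (y_succ_eq_zero q h')

/-- If `w_k` is a multiple of `y_{k+1}^2`, then `p_{k+1} ≠ -1`. -/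
theorem p_ne_neg_one {k : ℕ} (hy : y q (k + 2) ≠ 0)
    (hw : w q k ∈ Submodule.span 𝕜 {y q (k + 1) ^ 2}) : p q (k + 1) ≠ -1 := by
  intro hp
  obtain ⟨c, hc⟩ := Submodule.mem_span_singleton.1 hw
  have h := derPow_succ_w q k
  rw [← hc, map_smul, map_smul, derPow_sq, hp, add_neg_cancel, mul_zero, zero_smul, smul_zero,
    eq_comm] at h
  refine smul_ne_zero ?_ (y_ne_zero_of_le q (k + 1).le_succ hy) h
  simp [qFact_ne_zero q hy, yCoeff_ne_zero q hy]

/-- The coefficient of `y_{m+1}^2` in `w̃_m` is the quotient of the scalars in `derPow_succ_w` and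
`derPow_sq`. -/
theorem derPow_succ_wTilde {m : ℕ} (hp : p q (m + 1) ≠ -1) :
    derPow q (m + 1) (skewDer q 1 (wTilde q m)) = 0 := by
  have hp' : 1 + p q (m + 1) ≠ 0 := fun h => hp (by linear_combination h)
  rw [wTilde, map_sub, map_smul, map_sub, map_smul, derPow_succ_w, derPow_sq, qFact_succ _ (m + 1),
    yCoeff_succ q (m + 1), qβ_eq]
  match_scalars
  field_simp
  ring

theorem derPow_wTilde {m : ℕ} (hp : p q (m + 1) ≠ -1) :
    (1 + (q 0 0 : 𝕜)) • derPow q m (skewDer q 1 (wTilde q m)) =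
      (qFact (q 0 0 : 𝕜) m * yCoeff q m * (1 + (q 0 0 : 𝕜) -
        (1 + (q 0 0 : 𝕜)) * (p q (m + 1) / (q 0 0 : 𝕜)) ^ 2 +
        p q m * (qNum (q 0 0 : 𝕜) (m + 1) * qNum (q 0 0 : 𝕜) (m + 2)) *
          (1 - (q 0 0 : 𝕜) ^ m * qTilde q) * (1 - (q 0 0 : 𝕜) ^ (m + 1) * qTilde q) *
            (1 - p q (m + 1) / (q 0 0 : 𝕜)) / (1 + p q (m + 1)))) • y q (m + 2) := by
  have hp' : 1 + p q (m + 1) ≠ 0 := fun h => hp (by linear_combination h)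
  have hq : (q 0 0 : 𝕜) ≠ 0 := (q 0 0).ne_zero
  have h1 := derPow_gen_pow_add_two_mul_y q m m
  have h2 := derPow_y_mul_gen_pow_add_two q m m
  rw [wTilde, w, map_sub, map_sub, map_smul, map_smul, map_sub, map_sub, map_smul, map_smul,
    pow_two, derPow_skewDer_y_mul_y, derPow_skewDer_y_mul_y, derPow_skewDer_y_mul_y,
    derPow_y_mul_self, derPow_mul_y_self, derPow_gen_pow_succ_mul_y, derPow_y_mul_gen_pow_succ,
    gen_mul_y]
  generalize derPow q m (gen q 0 ^ (m + 2) * y q m) = A at *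
  generalize derPow q m (y q m * gen q 0 ^ (m + 2)) = B at *
  rw [gen_sq_mul_y] at h1
  -- `A` and `B` are known only after multiplication by `1 + q_{11}`, so that factor is moved onto
  -- them.
  have e : ∀ (c c' f g : 𝕜) (X Y S : NicholsAlgebra q),
      (1 + (q 0 0 : 𝕜)) • (X + c • A - f • (c' • B + Y) - g • S) =
      (1 + (q 0 0 : 𝕜)) • (X - f • Y - g • S) + c • ((1 + (q 0 0 : 𝕜)) • A) -
        (f * c') • ((1 + (q 0 0 : 𝕜)) • B) := by
    intros
    module
  rw [e, h1, h2]
  have hP := p_eq q (m + 1)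
  rw [p_eq q m, qβ_eq, qβ_eq, yCoeff_succ q (m + 1), yCoeff_succ q m, qFact_succ _ (m + 1),
    qFact_succ _ m]
  generalize p q (m + 1) = P at *
  simp only [qTilde] at hP ⊢
  -- Coefficients of `y_{m+2}`, `y_{m+1} x_1` and `y_m x_1^2`; only the first survives.
  match_scalars
  · field_simp
    rw [hP]
    ring
  · field_simp
    rw [hP]
    ring
  · ring

/-- Elements built from the `y_k` vanish as soon as `∂_1` and `∂_2` kill them. -/
theorem eq_zero_of_skewDer_zero_one {z : NicholsAlgebra q} (hc : counit q z = 0)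
    (h0 : skewDer q 0 z = 0) (h1 : skewDer q 1 z = 0) : z = 0 := by
  refine eq_zero_of_skewDer q hc fun i => ?_
  fin_cases i
  · exact h0
  · exact h1

theorem skewDer_zero_y_mul_y (a b : ℕ) : skewDer q 0 (y q a * y q b) = 0 := by
  rw [skewDer_mul, skewDer_zero_y, skewDer_zero_y, mul_zero, zero_mul, add_zero]

theorem skewDer_zero_wTilde (m : ℕ) : skewDer q 0 (wTilde q m) = 0 := by
  simp [wTilde, w, pow_two, skewDer_zero_y_mul_y]

theorem counit_wTilde (m : ℕ) : counit q (wTilde q m) = 0 := by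
  simp [wTilde, w, pow_two, counit_y]

/-! ### The braided commutator of consecutive `y_k`. -/

/-- The braided commutator of `y_{k+1}` and `y_k`. -/
def yComm (k : ℕ) : NicholsAlgebra q :=
  y q (k + 1) * y q k - qβ q (k + 1) k • (y q k * y q (k + 1))

theorem derPow_succ_yComm (k : ℕ) : derPow q (k + 1) (skewDer q 1 (yComm q k)) = 0 := by
  rw [yComm, map_sub, map_smul, map_sub, map_smul, derPow_skewDer_y_mul_y, derPow_skewDer_y_mul_y,
    derPow_y_mul_eq_zero q _ k.lt_succ_self, derPow_mul_y_eq_zero q _ k.lt_succ_self,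
    derPow_mul_y_self, derPow_y_mul_self, qβ_eq]
  match_scalars
  ring

theorem skewDer_yComm_mem {k : ℕ} (hk : qFact (q 0 0 : 𝕜) (k + 1) ≠ 0) :
    skewDer q 1 (yComm q k) ∈ genFiltration q (k + (k + 1)) (k + 1) := by
  refine mem_of_derPow_eq_zero q hk ?_ (derPow_succ_yComm q k)
  have h1 := skewDer_y_mul_y_mem q (k + 1) k
  have h2 := skewDer_y_mul_y_mem q k (k + 1)
  rw [max_eq_left k.le_succ, add_comm (k + 1) k] at h1
  rw [max_eq_right k.le_succ] at h2
  rw [yComm, map_sub, map_smul]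
  exact sub_mem h1 (Submodule.smul_mem _ _ h2)

/-- The coefficients of `y_{k+2} y_k` and `y_k y_{k+2}` occur in the ratio that defines `w_k`. -/
theorem leftDer_yComm_succ (k : ℕ) : ∃ c c' : 𝕜,
    leftDer q 0 (yComm q (k + 1)) = c • y q (k + 1) ^ 2 + c' • w q k := by
  refine ⟨yLower q (k + 1) -
      qβ q (k + 2) (k + 1) * ((q 0 0 : 𝕜) ^ (k + 1) * q 1 0 * yLower q (k + 1)),
    (q 0 0 : 𝕜) ^ (k + 2) * q 1 0 * yLower q k, ?_⟩
  rw [yComm, map_sub, map_smul, leftDer_y_mul_y, leftDer_y_mul_y, w, pow_two, qβ_eq, qβ_eq]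
  match_scalars <;> ring

/-- The braided commutator of `y_{k+1}` and `y_k` vanishes as soon as the leading coefficient of
its image under `∂_2` does. -/
theorem yComm_eq_zero {k : ℕ} (hy : y q (k + 1) ≠ 0)
    (hw : ∀ j < k, w q j ∈ Submodule.span 𝕜 {y q (j + 1) ^ 2})
    (h : derPow q k (skewDer q 1 (yComm q k)) = 0) : yComm q k = 0 := by
  have hk := qFact_ne_zero q hy
  have hk' := qFact_ne_zero_of_le _ k.le_succ hk
  have hmem := skewDer_yComm_mem q hk
  rw [show k + (k + 1) = k + 1 + k by ring] at hmem
  replace hmem := mem_of_derPow_eq_zero q hk' hmem h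
  refine eq_zero_of_skewDer_zero_one q (by simp [yComm, counit_y])
    (by simp [yComm, skewDer_zero_y_mul_y]) ?_
  cases k with
  | zero => simpa [genFiltration] using hmem
  | succ j =>
    have hwj := hw j j.lt_succ_self
    have hp := p_ne_neg_one q hy hwj
    obtain ⟨c, c', hc⟩ := leftDer_yComm_succ q j
    obtain ⟨l, hl⟩ := Submodule.mem_span_singleton.1 hwj
    rw [← hl, smul_smul, ← add_smul] at hc
    refine eq_zero_of_leftDer q (by omega) hk' hmem ?_
    -- The left derivative is now a multiple of `y_{j+1}^2`. Since `p_{j+1} ≠ -1`, `∂_1^{j+1} ∂_2`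
    -- detects the scalar, and `h` says that the result is zero.
    have h' := derPow_leftDer q (j + 1) (skewDer q 1 (yComm q (j + 1)))
    rw [h, map_zero, ← skewDer_leftDer, hc, map_smul, map_smul, derPow_sq, smul_smul] at h'
    have hy' := y_ne_zero_of_le q (j + 1).le_succ hy
    have hp' : 1 + p q (j + 1) ≠ 0 := fun h => hp (by linear_combination h)
    have hcoeff : c + c' * l = 0 := by
      rcases smul_eq_zero.1 h' with h' | h'
      · simpa [hk', yCoeff_ne_zero q hy', hp'] using h'
      · exact absurd h' hy'
    rw [← skewDer_leftDer, hc, hcoeff, zero_smul, map_zero]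

/-! ### The left derivative of `w̃_m` and the equivalences. -/

theorem leftDer_sq (k : ℕ) : ∃ c c' : 𝕜, leftDer q 0 (y q (k + 1) ^ 2) =
    c • (y q (k + 1) * y q k) + c' • (y q k * y q (k + 1)) :=
  ⟨(q 0 0 : 𝕜) ^ (k + 1) * q 1 0 * yLower q k, yLower q k, by
    rw [pow_two, leftDer_y_mul_y, add_comm]⟩

/-- For `m > 0` the unwanted terms are `y_{m+2} y_{m-1}` and `y_{m-1} y_{m+2}`. Applying `ad_c x_1`
to the relation `w_{m-1} = l y_m^2` expresses the first through the other products, after which the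
second cancels. -/
theorem leftDer_w {m : ℕ} (hw : ∀ k < m, w q k ∈ Submodule.span 𝕜 {y q (k + 1) ^ 2}) :
    ∃ c c' : 𝕜, leftDer q 0 (w q m) =
      c • (y q (m + 1) * y q m) + c' • (y q m * y q (m + 1)) := by
  cases m with
  | zero =>
    refine ⟨yLower q 1, -(qβ q 2 0 * (q 1 0 * yLower q 1)), ?_⟩
    rw [w, map_sub, map_smul, leftDer_y_mul_y_zero, leftDer_y_zero_mul_y]
    module
  | succ j =>
    obtain ⟨l, hl⟩ := Submodule.mem_span_singleton.1 (hw j j.lt_succ_self)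
    have h := congrArg (adc q 0) hl
    have hsub : w q j = y q (j + 2) * y q j + (-qβ q (j + 2) j) • (y q j * y q (j + 2)) := by
      rw [w, neg_smul, sub_eq_add_neg]
    rw [hsub, adc_smul, pow_two, adc_add, adc_smul, adc_y_mul_y, adc_y_mul_y, adc_y_mul_y] at h
    rw [w, map_sub, map_smul, leftDer_y_mul_y, leftDer_y_mul_y]
    have h3 : y q (j + 3) * y q j =
        l • (y q (j + 2) * y q (j + 1) + ((q 0 0 : 𝕜) ^ (j + 1) * q 0 1) •
          (y q (j + 1) * y q (j + 2))) - ((q 0 0 : 𝕜) ^ (j + 2) * q 0 1) •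
          (y q (j + 2) * y q (j + 1)) + qβ q (j + 2) j • (y q (j + 1) * y q (j + 2) +
            ((q 0 0 : 𝕜) ^ j * q 0 1) • (y q j * y q (j + 3))) := by
      rw [h]
      module
    refine ⟨yLower q (j + 2) + (q 0 0 : 𝕜) ^ (j + 3) * q 1 0 * yLower q j *
        (l - (q 0 0 : 𝕜) ^ (j + 2) * q 0 1),
      (q 0 0 : 𝕜) ^ (j + 3) * q 1 0 * yLower q j *
        (l * ((q 0 0 : 𝕜) ^ (j + 1) * q 0 1) + qβ q (j + 2) j) -
        qβ q (j + 3) (j + 1) * ((q 0 0 : 𝕜) ^ (j + 1) * q 1 0 * yLower q (j + 2)), ?_⟩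
    change yLower q (j + 2) • (y q (j + 2) * y q (j + 1)) +
      ((q 0 0 : 𝕜) ^ (j + 3) * q 1 0 * yLower q j) • (y q (j + 3) * y q j) -
        qβ q (j + 3) (j + 1) • (yLower q j • (y q j * y q (j + 3)) +
          ((q 0 0 : 𝕜) ^ (j + 1) * q 1 0 * yLower q (j + 2)) • (y q (j + 1) * y q (j + 2))) = _
    rw [h3, qβ_eq, qβ_eq]
    match_scalars <;> ring

/-- This basis is chosen because `∂_1^{m+1} ∂_2` kills the commutator and so isolates `c'`. -/
theorem leftDer_wTilde {m : ℕ} (hw : ∀ k < m, w q k ∈ Submodule.span 𝕜 {y q (k + 1) ^ 2}) :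
    ∃ c c' : 𝕜, leftDer q 0 (wTilde q m) = c • yComm q m + c' • (y q m * y q (m + 1)) := by
  obtain ⟨a, a', ha⟩ := leftDer_w q hw
  obtain ⟨b, b', hb⟩ := leftDer_sq q m
  rw [wTilde, map_sub, map_smul, ha, hb]
  generalize qβ q (m + 1) m * qNum (q 0 0 : 𝕜) (m + 2) *
    (1 - (q 0 0 : 𝕜) ^ (m + 1) * qTilde q) / (1 + p q (m + 1)) = C
  refine ⟨a - C * b, a' - C * b' + (a - C * b) * qβ q (m + 1) m, ?_⟩
  rw [yComm]
  module

theorem skewDer_wTilde_mem (m : ℕ) :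
    skewDer q 1 (wTilde q m) ∈ genFiltration q (m + (m + 2)) (m + 3) := by
  have h1 := skewDer_y_mul_y_mem q (m + 2) m
  have h2 := skewDer_y_mul_y_mem q m (m + 2)
  have h3 := skewDer_y_mul_y_mem q (m + 1) (m + 1)
  rw [max_eq_left (by omega), add_comm (m + 2) m] at h1
  rw [max_eq_right (by omega)] at h2
  rw [max_self, show m + 1 + (m + 1) = m + (m + 2) by ring] at h3
  rw [wTilde, w, pow_two, map_sub, map_sub, map_smul, map_smul]
  exact sub_mem (sub_mem h1 (Submodule.smul_mem _ _ h2))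
    (Submodule.smul_mem _ _ (genFiltration_mono q _ (by omega) h3))

theorem wTilde_eq_zero {m : ℕ} (hy : y q (m + 2) ≠ 0) (hp : p q (m + 1) ≠ -1)
    (hw : ∀ k < m, w q k ∈ Submodule.span 𝕜 {y q (k + 1) ^ 2})
    (h : derPow q m (skewDer q 1 (wTilde q m)) = 0) : wTilde q m = 0 := by
  have hy1 := y_ne_zero_of_le q (m + 1).le_succ hy
  have hy0 := y_ne_zero_of_le q m.le_succ hy1
  have hf2 := qFact_ne_zero q hy
  have hf1 := qFact_ne_zero q hy1
  have hf0 := qFact_ne_zero q hy0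
  have hleft : leftDer q 0 (wTilde q m) = 0 := by
    obtain ⟨c, c', hc⟩ := leftDer_wTilde q hw
    have hD : ∀ n, derPow q n (skewDer q 1 (leftDer q 0 (wTilde q m))) =
        leftDer q 0 (derPow q n (skewDer q 1 (wTilde q m))) := fun n => by
      rw [skewDer_leftDer, derPow_leftDer]
    have hc' : c' = 0 := by
      have := hD (m + 1)
      rw [derPow_succ_wTilde q hp, hc, map_zero, map_add, map_add, map_smul, map_smul,
        derPow_succ_yComm, map_smul, map_smul, derPow_skewDer_y_mul_y, derPow_y_mul_self,
        derPow_mul_y_eq_zero q _ m.lt_succ_self, smul_zero, smul_zero, zero_add, add_zero] at this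
      simpa [hf1, hy0, yCoeff_ne_zero q hy1] using this
    rw [hc', zero_smul, add_zero] at hc
    have h0 := hD m
    rw [h, hc, map_zero, map_smul, map_smul] at h0
    rw [hc]
    rcases smul_eq_zero.1 h0 with h0 | h0
    · rw [h0, zero_smul]
    · rw [yComm_eq_zero q hy1 hw h0, smul_zero]
  refine eq_zero_of_skewDer_zero_one q (counit_wTilde q m) (skewDer_zero_wTilde q m) ?_
  have hmem := skewDer_wTilde_mem q m
  -- The levels `m + 2`, `m + 1` and `m` are now peeled off in turn; the remaining combination
  -- involves only `y_i` with `i > m + 2`, where the left derivation is injective.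
  have h2 : derPow q (m + 2) (skewDer q 1 (wTilde q m)) = 0 := by
    rw [wTilde, map_sub, map_smul, map_sub, map_smul, derPow_add_two_w, derPow_succ_sq, smul_zero,
      sub_zero]
  replace hmem := mem_of_derPow_eq_zero q hf2 hmem h2
  rw [show m + (m + 2) = m + 1 + (m + 1) by ring] at hmem
  replace hmem := mem_of_derPow_eq_zero q hf1 hmem (derPow_succ_wTilde q hp)
  rw [show m + 1 + (m + 1) = m + 2 + m by ring] at hmem
  replace hmem := mem_of_derPow_eq_zero q hf0 hmem h
  exact eq_zero_of_leftDer q (by omega) hf0 hmem (by rw [← skewDer_leftDer, hleft, map_zero])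

/-- Here `w̃_m` is a multiple of `y_{m+1}^2`, whose image under `∂_1^{m+1} ∂_2` is non-zero, while
that of `w̃_m` is zero. -/
theorem wTilde_eq_zero_of_mem_span {m : ℕ} (hy : y q (m + 2) ≠ 0) (hp : p q (m + 1) ≠ -1)
    (h : w q m ∈ Submodule.span 𝕜 {y q (m + 1) ^ 2}) : wTilde q m = 0 := by
  have hy1 := y_ne_zero_of_le q (m + 1).le_succ hy
  have hp' : 1 + p q (m + 1) ≠ 0 := fun h => hp (by linear_combination h)
  have h0 := derPow_succ_wTilde q hp
  obtain ⟨l, hl⟩ := Submodule.mem_span_singleton.1 h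
  rw [wTilde, ← hl, ← sub_smul] at h0 ⊢
  rw [map_smul, map_smul, derPow_sq] at h0
  rcases smul_eq_zero.1 h0 with h0 | h0
  · rw [h0, zero_smul]
  · simp [qFact_ne_zero q hy1, yCoeff_ne_zero q hy1, hy1, hp'] at h0

theorem derPow_wTilde_eq_zero_iff {m : ℕ} (hy : y q (m + 2) ≠ 0) (hp : p q (m + 1) ≠ -1) :
    derPow q m (skewDer q 1 (wTilde q m)) = 0 ↔
      0 = (1 - p q (m + 1) / (q 0 0 : 𝕜)) *
        (1 + p q (m + 1) / (q 0 0 : 𝕜) +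
          p q m * qFact (q 0 0 : 𝕜) (m + 2) * (1 - (q 0 0 : 𝕜) ^ m * qTilde q) *
              (1 - (q 0 0 : 𝕜) ^ (m + 1) * qTilde q) /
            (qFact (q 0 0 : 𝕜) m * (1 + (q 0 0 : 𝕜)) * (1 + p q (m + 1)))) := by
  have hp' : 1 + p q (m + 1) ≠ 0 := fun h => hp (by linear_combination h)
  have hy0 := y_ne_zero_of_le q (m.le_add_right 2) hy
  have hq : (q 0 0 : 𝕜) ≠ 0 := (q 0 0).ne_zero
  have h2 : 1 + (q 0 0 : 𝕜) ≠ 0 := by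
    rw [← qFact_two]
    exact qFact_ne_zero_of_le _ (Nat.le_add_left 2 m) (qFact_ne_zero q hy)
  have hf := qFact_ne_zero q hy0
  have ha := yCoeff_ne_zero q hy0
  rw [← smul_eq_zero_iff_right h2, derPow_wTilde q hp, smul_eq_zero_iff_left hy,
    qFact_succ _ (m + 1), qFact_succ _ m]
  -- The scalar in `derPow_wTilde` is the right-hand side of condition 4 times the non-zero factor
  -- `m! · yCoeff q m · (1 + q_{11})`.
  refine (Eq.congr_left ?_).trans
    ((mul_eq_zero_iff_left (mul_ne_zero (mul_ne_zero hf ha) h2)).trans eq_comm)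
  field_simp
  ring

end RankTwo

end NicholsDiag

end

open NicholsDiag in
theorem lemma4 {𝕜 : Type*} [Field 𝕜] [IsAlgClosed 𝕜] [CharZero 𝕜] (q : Fin 2 → Fin 2 → 𝕜ˣ) (m : ℕ)
    (hy : y q (m + 2) ≠ 0) (hp : p q (m + 1) ≠ -1)
    (hw : ∀ k < m, w q k ∈ Submodule.span 𝕜 {y q (k + 1) ^ 2}) :
    List.TFAE [
      w q m ∈ Submodule.span 𝕜 {y q (m + 1) ^ 2},
      wTilde q m = 0,
      (skewDer q 0)^[m] (skewDer q 1 (wTilde q m)) = 0,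
      0 = (1 - p q (m + 1) / (q 0 0 : 𝕜)) *
        (1 + p q (m + 1) / (q 0 0 : 𝕜) +
          p q m * qFact (q 0 0 : 𝕜) (m + 2) * (1 - (q 0 0 : 𝕜) ^ m * qTilde q) *
              (1 - (q 0 0 : 𝕜) ^ (m + 1) * qTilde q) /
            (qFact (q 0 0 : 𝕜) m * (1 + (q 0 0 : 𝕜)) * (1 + p q (m + 1))))] := by
  rw [← Module.End.pow_apply]
  tfae_have 1 → 2 := wTilde_eq_zero_of_mem_span q hy hp
  tfae_have 2 → 1 := fun h =>
    Submodule.mem_span_singleton.2 ⟨_, (sub_eq_zero.1 h).symm⟩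
  tfae_have 2 → 3 := fun h => by rw [h, map_zero, map_zero]
  tfae_have 3 → 2 := wTilde_eq_zero q hy hp hw
  tfae_have 3 ↔ 4 := derPow_wTilde_eq_zero_iff q hy hp
  tfae_finish
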